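/- Let $\lambda_{BS},\lambda_{MT},P,W,K,\gamma,\theta>0$ and $\alpha>2$, and put $L=1-\bigl(1+\tfrac{\lambda_{MT}}{3.5\,\lambda_{BS}}\bigr)^{-3.5}$ and $\ell(r)=Kr^{\alpha}$. Network. The base stations (BSs) form a homogeneous Poisson point process of intensity $\lambda_{BS}$ in $\mathbb R^2$, and a typical user sits at the origin. Each BS is active with probability $L$, independently of the other BSs and of all locations. Let $r_n$ be the distance of BS $n$ to the origin. The user is served by the BS with the smallest path loss $\ell(r_n)$, i.e. by the nearest one; call it BS $0$, at distance $r_0$. The interferers $\Phi_I$ are all active BSs other than BS $0$. (Hence $r_0$ has density $2\pi\lambda_{BS}r_0e^{-\pi\lambda_{BS}r_0^2}$ and, given $r_0$, $\Phi_I$ is a Poisson process with intensity $\lambda_{BS}L\,\mathbf 1(r>r_0)$.) The realization $\Phi$ of locations and activity states does not change in time. Fading. In the time slots $t=1,2,\dots$ the power fading coefficients $h_n=h_n(t)$ of the links from the BSs to the user are independent over $n$ and $t$, exponential with mean $1$, and independent of $\Phi$. In a slot let $$S=\frac{Ph_0}{\ell(r_0)},\quad I=\sum_{i\in\Phi_I}\frac{Ph_i}{\ell(r_i)},\quad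 \mathrm{SIR}=\frac SI,\quad \mathrm{SINR}=\frac S{I+W},\quad \mathrm{ASNR}=\frac P{W\ell(r_0)} .$$ The user is covered in the slot if: $\mathrm{SIR}>\gamma$ (SIR-based criterion); $\mathrm{SINR}>\gamma$ (SINR-based criterion); $\mathrm{SIR}>\gamma$ and $\mathrm{ASNR}>\theta$ (SIR+ASNR-based criterion). Let $\Delta_\Phi\in\{1,2,\dots\}\cup\{\infty\}$ be the first slot in which the user is covered, and, for $\tau\in\{0,1,2,\dots\}$, let $$F_1(\tau)=\mathbb E_\Phi\bigl[\mathbb P_h[\Delta_\Phi>\tau\mid\Phi]\bigr],$$ where $\mathbb P_h$ is the probability over the fading with $\Phi$ fixed and $\mathbb E_\Phi$ is the expectation over $\Phi$. Let $\mathcal G(r_0)=1$ for the SIR-based criterion, $\mathcal G(r_0)=e^{-\gamma WKr_0^\alpha/P}$ for the SINR-based criterion, and $\mathcal G(r_0)=\mathbf 1\bigl(r_0\le (P/(KW\theta))^{1/\alpha}\bigr)$ for the SIR+ASNR-based criterion. Let $$\mathcal F(k,\alpha,\gamma)=1+L\,\Bigl({}_2F_1\bigl(-\tfrac2\alpha,k;1-\tfrac2\alpha;-\gamma\bigr)-1\Bigr),$$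 with ${}_2F_1(a,b;c;\cdot)$ the analytic continuation of the Gauss hypergeometric series to $(-\infty,1)$. Theorem. For each of the three coverage criteria and every $\tau\in\{0,1,2,\dots\}$, the conditional probability $\mathbb P_h[\Delta_\Phi>\tau\mid\Phi]$ is an integrable function of $\Phi$, the integrals below converge absolutely, and, with $\mathcal G(r_0)^0=1$, $$F_1(\tau)=2\pi\lambda_{BS}\sum_{k=0}^{\tau}\binom{\tau}{k}(-1)^k\int_0^\infty \mathcal G(r_0)^k\,e^{-\pi\lambda_{BS}r_0^2\,\mathcal F(k,\alpha,\gamma)}\,r_0\,dr_0 .$$ -/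

import Mathlib

open MeasureTheory ProbabilityTheory Set Filter Topology
open scoped ENNReal NNReal

namespace CellularDelay

noncomputable section

/-! ### The Gauss hypergeometric function on `(-∞, 1)` -/

/-- `f` is a real-analytic continuation to `(-∞, 1)` of the power series
`∑ (a)_n (b)_n / ((c)_n n!) x ^ n`. -/
def IsHypContinuation (a b c : ℝ) (f : ℝ → ℝ) : Prop :=
  AnalyticOnNhd ℝ f (Iio 1) ∧ f =ᶠ[𝓝 0] fun x => ordinaryHypergeometric a b c x

/-- The continuation is unique. -/
theorem IsHypContinuation.eqOn {a b c : ℝ} {f g : ℝ → ℝ}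
    (hf : IsHypContinuation a b c f) (hg : IsHypContinuation a b c g) :
    EqOn f g (Iio 1) :=
  hf.1.eqOn_of_preconnected_of_eventuallyEq hg.1 isPreconnected_Iio
    (show (0 : ℝ) ∈ Iio (1 : ℝ) by simp) (hf.2.trans hg.2.symm)

open Classical in
/-- The Gauss hypergeometric function `₂F₁(a, b; c; x)` for real `x < 1`: the analytic continuation
of the hypergeometric series (Mathlib's `ordinaryHypergeometric` is only the series itself, which
diverges for `x < -1`). -/
def hyp2F1 (a b c x : ℝ) : ℝ :=
  if h : ∃ f : ℝ → ℝ, IsHypContinuation a b c f then h.choose x else 0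

/-- `hyp2F1` agrees on `(-∞, 1)` with every analytic continuation of the series. -/
theorem hyp2F1_eq {a b c : ℝ} {f : ℝ → ℝ} (hf : IsHypContinuation a b c f) {x : ℝ} (hx : x < 1) :
    hyp2F1 a b c x = f x := by
  have h : ∃ f : ℝ → ℝ, IsHypContinuation a b c f := ⟨f, hf⟩
  unfold hyp2F1
  rw [dif_pos h]
  exact h.choose_spec.eqOn hf hx

/-! ### Parameters -/

/-- The parameters of the network. -/
structure Params where
  /-- density of the base stations -/
  lamBS : ℝ
  /-- density of the mobile terminals -/
  lamMT : ℝ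
  /-- transmit power -/
  P : ℝ
  /-- noise power -/
  W : ℝ
  /-- path-loss constant -/
  K : ℝ
  /-- path-loss exponent -/
  α : ℝ
  /-- decoding threshold -/
  γ : ℝ
  /-- detection threshold -/
  θ : ℝ
  lamBS_pos : 0 < lamBS
  lamMT_pos : 0 < lamMT
  P_pos : 0 < P
  W_pos : 0 < W
  K_pos : 0 < K
  two_lt_α : 2 < α
  γ_pos : 0 < γ
  θ_pos : 0 < θ

/-- The three coverage criteria. -/
inductive Criterion where
  /-- SIR-based coverage -/
  | sir
  /-- SINR-based coverage -/
  | sinr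
  /-- SIR+ASNR-based coverage -/
  | sirAsnr

namespace Params

variable (p : Params)

/-- The probability `L(λ_BS, λ_MT)` that a base station is active. -/
def activeProb : ℝ := 1 - (1 + p.lamMT / (3.5 * p.lamBS)) ^ (-3.5 : ℝ)

/-- The path loss `ℓ(r) = K r ^ α` over a link of length `r` (the received power is the transmitted
power, times the fading, divided by `ℓ(r)`). -/
def pathLoss (r : ℝ) : ℝ := p.K * r ^ p.α

/-- The function `𝓕(k, α, γ) = 1 + L (₂F₁(-2/α, k; 1 - 2/α; -γ) - 1)`. -/
def calF (k : ℕ) : ℝ :=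
  1 + p.activeProb * (hyp2F1 (-2 / p.α) k (1 - 2 / p.α) (-p.γ) - 1)

open Classical in
/-- The criterion-dependent function `𝓖`. -/
def calG : Criterion → ℝ → ℝ
  | .sir, _ => 1
  | .sinr, r => Real.exp (-(p.γ * p.W * p.K * r ^ p.α / p.P))
  | .sirAsnr, r => if r ≤ (p.P / (p.K * p.W * p.θ)) ^ (1 / p.α) then 1 else 0

end Params

/-! ### The point process of base stations -/

/-- The plane; the typical user is at the origin. -/
abbrev Plane : Type := EuclideanSpace ℝ (Fin 2)

/-- The number of points of the configuration `x` in `B`. -/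
def pointCount (x : ℕ → Plane) (B : Set Plane) : ℕ∞ := {n : ℕ | x n ∈ B}.encard

/-- The points `X 0, X 1, …` (labelled in an arbitrary measurable way) form a homogeneous Poisson
point process of intensity `lam > 0` on the plane. -/
structure IsHomogeneousPPP {Ω : Type*} [MeasurableSpace Ω] (μ : Measure Ω)
    (X : ℕ → Ω → Plane) (lam : ℝ) : Prop where
  measurable : ∀ n, Measurable (X n)
  /-- the number of points in a set of finite area is Poisson with mean `lam * area` -/
  count_law : ∀ B : Set Plane, MeasurableSet B → volume B ≠ ∞ →
    HasLaw (fun ω => pointCount (fun n => X n ω) B)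
      ((poissonMeasure (ENNReal.ofReal lam * volume B).toNNReal).map (Nat.cast : ℕ → ℕ∞)) μ
  /-- the numbers of points in disjoint sets are independent -/
  count_indep : ∀ (m : ℕ) (B : Fin m → Set Plane), (∀ i, MeasurableSet (B i)) →
    Pairwise (fun i j => Disjoint (B i) (B j)) →
    iIndepFun (fun i ω => pointCount (fun n => X n ω) (B i)) μ

/-- The law of the network: base stations `X` forming a homogeneous Poisson point process of
density `λ_BS`, with activity marks `A n` that are i.i.d., equal to `true` with probability
`L(λ_BS, λ_MT)`, and independent of the locations. -/
structure IsNetwork {Ω : Type*} [MeasurableSpace Ω] (μ : Measure Ω) (p : Params)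
    (X : ℕ → Ω → Plane) (A : ℕ → Ω → Bool) : Prop where
  ppp : IsHomogeneousPPP μ X p.lamBS
  measurable_active : ∀ n, Measurable (A n)
  active_prob : ∀ n, μ {ω | A n ω = true} = ENNReal.ofReal p.activeProb
  active_indep : iIndepFun A μ
  indep : IndepFun (fun ω n => X n ω) (fun ω n => A n ω) μ

/-- The law of the fading: `h t n` is the power fading coefficient, in time slot `t`, of the link
from base station `n` to the typical user; all are i.i.d. exponential with unit mean (Rayleigh
fading). -/
structure IsRayleighFading {Ω' : Type*} [MeasurableSpace Ω'] (ν : Measure Ω')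
    (h : ℕ → ℕ → Ω' → ℝ) : Prop where
  measurable : ∀ t n, Measurable (h t n)
  law : ∀ t n, HasLaw (h t n) (expMeasure 1) ν
  indep : iIndepFun (fun (q : ℕ × ℕ) => h q.1 q.2) ν

/-! ### Signal, interference and delay for a fixed network realization -/

namespace Params

variable (p : Params)

/-- The (label of the) serving base station: the one received with the highest average power, i.e.
with the smallest path loss (ties and configurations without a minimum have probability zero). -/
def serving (x : ℕ → Plane) : ℕ :=
  sInf {n : ℕ | ∀ m, p.pathLoss ‖x n‖ ≤ p.pathLoss ‖x m‖}

/-- The interfering base stations: all active ones other than the serving one. -/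
def interferers (x : ℕ → Plane) (a : ℕ → Bool) : Set ℕ :=
  {n | n ≠ p.serving x ∧ a n = true}

/-- The power `P g / ℓ(‖y‖)` received at the origin from a base station at `y` under the power
fading coefficient `g`. -/
def receivedPower (y : Plane) (g : ℝ) : ℝ≥0∞ :=
  ENNReal.ofReal (p.P * g) / ENNReal.ofReal (p.pathLoss ‖y‖)

/-- The signal `S`, for the fading coefficients `g` of one time slot. -/
def signal (x : ℕ → Plane) (g : ℕ → ℝ) : ℝ≥0∞ :=
  p.receivedPower (x (p.serving x)) (g (p.serving x))

/-- The interference `I`, for the fading coefficients `g` of one time slot. -/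
def interference (x : ℕ → Plane) (a : ℕ → Bool) (g : ℕ → ℝ) : ℝ≥0∞ :=
  ∑' n : p.interferers x a, p.receivedPower (x n) (g n)

/-- The signal-to-interference ratio. -/
def SIR (x : ℕ → Plane) (a : ℕ → Bool) (g : ℕ → ℝ) : ℝ≥0∞ :=
  p.signal x g / p.interference x a g

/-- The signal-to-interference-plus-noise ratio. -/
def SINR (x : ℕ → Plane) (a : ℕ → Bool) (g : ℕ → ℝ) : ℝ≥0∞ :=
  p.signal x g / (p.interference x a g + ENNReal.ofReal p.W)

/-- The average signal-to-noise ratio. -/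
def ASNR (x : ℕ → Plane) : ℝ≥0∞ :=
  ENNReal.ofReal p.P / ENNReal.ofReal (p.W * p.pathLoss ‖x (p.serving x)‖)

/-- The typical user is covered in a time slot with fading coefficients `g`. -/
def Covered (c : Criterion) (x : ℕ → Plane) (a : ℕ → Bool) (g : ℕ → ℝ) : Prop :=
  match c with
  | .sir => ENNReal.ofReal p.γ < p.SIR x a g
  | .sinr => ENNReal.ofReal p.γ < p.SINR x a g
  | .sirAsnr => ENNReal.ofReal p.γ < p.SIR x a g ∧ ENNReal.ofReal p.θ < p.ASNR x

/-- `Δ_Φ`, the number of time slots until the first success: the first of the slots `1, 2, 3, …`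
in which the typical user is covered (`⊤` if there is none). Here `g t n` is the fading coefficient
of base station `n` in slot `t`. -/
def delay (c : Criterion) (x : ℕ → Plane) (a : ℕ → Bool) (g : ℕ → ℕ → ℝ) : ℕ∞ :=
  ⨅ (t : ℕ) (_ : 1 ≤ t ∧ p.Covered c x a (g t)), (t : ℕ∞)

/-- `ℙ_h[Δ_Φ > τ | Φ]` for the network realization `(x, a)`: only the fading is random. -/
def condDelayCCDF {Ω' : Type*} [MeasurableSpace Ω'] (ν : Measure Ω') (h : ℕ → ℕ → Ω' → ℝ)
    (c : Criterion) (x : ℕ → Plane) (a : ℕ → Bool) (τ : ℕ) : ℝ :=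
  ν.real {ω' | (τ : ℕ∞) < p.delay c x a (fun t n => h t n ω')}

/-- `F₁(τ) = 𝔼_Φ[ℙ_h[Δ_Φ > τ | Φ]]`. -/
def F₁ {Ω Ω' : Type*} [MeasurableSpace Ω] [MeasurableSpace Ω'] (μ : Measure Ω) (ν : Measure Ω')
    (X : ℕ → Ω → Plane) (A : ℕ → Ω → Bool) (h : ℕ → ℕ → Ω' → ℝ) (c : Criterion) (τ : ℕ) : ℝ :=
  ∫ ω, p.condDelayCCDF ν h c (fun n => X n ω) (fun n => A n ω) τ ∂μ

end Params

end

end CellularDelay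

/-!
The slots are independent given the network `(x, a)`, so that `ℙ_h[Δ_Φ > τ | Φ] = (1 - q) ^ τ`,
where `q` is the conditional probability of coverage in one slot (`Params.condDelayCCDF_eq`). By
the binomial theorem only the moments `𝔼[q ^ k]` are needed (`IsNetwork.lintegral_coverProb_pow`).

*Fading.* The threshold condition on the SIR or SINR means that the exponential coefficient of the
serving link exceeds an independent quantity `Y`, a constant plus a weighted sum of exponential
coefficients. It has probability `𝔼 e ^ (-Y)`; with the condition on the ASNR, if there is one,
this gives `q = 𝓖(r₀) ∏ (1 + γ (r₀ / rₙ) ^ α)⁻¹` over the interferers (`Params.measure_covered`).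
Infinite products are written as `expNeg (∑' n, φ n)` with exponents in `[0, ∞]`, so that no
convergence question arises. Averaging `q ^ k` over the activity marks replaces the factor of
station `n` by `1 - w (r₀ / rₙ)`, where `w x = L (1 - (1 + γ x ^ α) ^ (-k))`
(`Params.lintegral_coverProb_pow_active`). At the serving station this factor would be the
constant `1 - w 1`, so the product over the other stations is the product over all stations
divided by `1 - w 1`.

*Poisson process.* The counts in disjoint sets give the Laplace functional
`𝔼 ∏ e ^ (-φ (X n)) = exp (-lam ∫ (1 - e ^ (-φ)))`, for step functions and then by monotone
limits (`IsHomogeneousPPP.laplace`). Applied to an exponent that is `∞` near the origin, it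
yields, for a fixed scale `s`, the tail of the nearest distance `R` under the weight
`∏ (1 - w (s / ‖X n‖))`, and hence its density. The scale is made equal to `R` by replacing it
first by the dyadic approximation of `R` from below, which takes countably many values, and
passing to the limit (`IsHomogeneousPPP.lintegral_nearest`).

*Hypergeometric function.* The exponent of the resulting density is an integral of
`r w (r₀ / r)` over `r > r₀`. It is evaluated by
`₂F₁(-2/α, k; 1 - 2/α; x) = 1 + ∫ t in (1, ∞), 2 t (1 - (1 - x t ^ (-α)) ^ (-k))`,
whose right side is holomorphic for `re x < 1` and agrees with the series near `0`, by termwise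
integration of the binomial series (`isHypContinuation_hypExcess`).
-/

namespace CellularDelay

/-! ### The exponential of a negated extended nonnegative number -/

/-- `e ^ (-y)` for `y ∈ [0, ∞]`, with `e ^ (-∞) = 0`. -/
noncomputable def expNeg (y : ℝ≥0∞) : ℝ≥0∞ := EReal.exp (-(y : EReal))

lemma continuous_expNeg : Continuous expNeg :=
  ENNReal.continuous_exp.comp (continuous_neg.comp continuous_coe_ennreal_ereal)

@[fun_prop]
lemma measurable_expNeg : Measurable expNeg := continuous_expNeg.measurable

@[simp] lemma expNeg_zero : expNeg 0 = 1 := by simp [expNeg]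

@[simp] lemma expNeg_top : expNeg ⊤ = 0 := by simp [expNeg]

lemma antitone_expNeg : Antitone expNeg := fun a b hab => by
  unfold expNeg
  exact EReal.exp_monotone (EReal.neg_le_neg_iff.2 (by exact_mod_cast hab))

lemma expNeg_le_one (y : ℝ≥0∞) : expNeg y ≤ 1 := by
  simpa using antitone_expNeg (zero_le (a := y))

lemma expNeg_ne_top (y : ℝ≥0∞) : expNeg y ≠ ⊤ :=
  ne_top_of_le_ne_top ENNReal.one_ne_top (expNeg_le_one y)

lemma expNeg_ofReal {x : ℝ} (hx : 0 ≤ x) :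
    expNeg (ENNReal.ofReal x) = ENNReal.ofReal (Real.exp (-x)) := by
  unfold expNeg
  rw [EReal.coe_ennreal_ofReal, max_eq_left hx, ← EReal.coe_neg, EReal.exp_coe]

lemma expNeg_add (a b : ℝ≥0∞) : expNeg (a + b) = expNeg a * expNeg b := by
  unfold expNeg
  rw [← EReal.exp_add, EReal.coe_ennreal_add, EReal.neg_add (by simp) (by simp), sub_eq_add_neg]

lemma expNeg_sum {ι : Type*} (s : Finset ι) (f : ι → ℝ≥0∞) :
    expNeg (∑ i ∈ s, f i) = ∏ i ∈ s, expNeg (f i) := by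
  classical
  induction s using Finset.induction_on with
  | empty => simp
  | insert a s ha ih => rw [Finset.sum_insert ha, Finset.prod_insert ha, expNeg_add, ih]

lemma expNeg_nat_mul (n : ℕ) (a : ℝ≥0∞) : expNeg (n * a) = expNeg a ^ n := by
  have := expNeg_sum (Finset.range n) (fun _ => a)
  simpa using this

lemma expNeg_ofReal_neg_log {x : ℝ} (hx : 0 < x) (hx1 : x ≤ 1) :
    expNeg (ENNReal.ofReal (-Real.log x)) = ENNReal.ofReal x := by
  rw [expNeg_ofReal (by linarith [Real.log_nonpos hx.le hx1]), neg_neg, Real.exp_log hx]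

lemma tendsto_lintegral_expNeg {Ω : Type*} [MeasurableSpace Ω] {μ : Measure Ω} [IsFiniteMeasure μ]
    {Y : ℕ → Ω → ℝ≥0∞} {Z : Ω → ℝ≥0∞} (hY : ∀ n, AEMeasurable (Y n) μ)
    (h : ∀ᵐ ω ∂μ, Tendsto (fun n => Y n ω) atTop (𝓝 (Z ω))) :
    Tendsto (fun n => ∫⁻ ω, expNeg (Y n ω) ∂μ) atTop (𝓝 (∫⁻ ω, expNeg (Z ω) ∂μ)) := by
  refine tendsto_lintegral_of_dominated_convergence' (fun _ => 1)
    (fun n => measurable_expNeg.comp_aemeasurable (hY n))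
    (fun n => Eventually.of_forall fun ω => expNeg_le_one _) (by simp) ?_
  filter_upwards [h] with ω hω
  exact (continuous_expNeg.tendsto _).comp hω

/-! ### Laplace transforms of sums of independent variables -/

section Sums

variable {Ω : Type*} [MeasurableSpace Ω] {μ : Measure Ω}

lemma lintegral_expNeg_sum {ι : Type*} {Z : ι → Ω → ℝ≥0∞} {z : ι → ℝ≥0∞}
    (hm : ∀ i, Measurable (Z i)) (hi : iIndepFun Z μ)
    (hz : ∀ i, ∫⁻ ω, expNeg (Z i ω) ∂μ = expNeg (z i)) (s : Finset ι) :
    ∫⁻ ω, expNeg (∑ i ∈ s, Z i ω) ∂μ = expNeg (∑ i ∈ s, z i) := by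
  simp_rw [expNeg_sum, ← hz]
  exact lintegral_prod_eq_prod_lintegral_of_indepFun s (fun i ω => expNeg (Z i ω))
    (hi.comp (fun _ => expNeg) fun _ => measurable_expNeg) fun i => measurable_expNeg.comp (hm i)

/-- The Laplace transform at `1` of a countable sum of independent `[0, ∞]`-valued variables.
The sum may be infinite with positive probability. -/
lemma lintegral_expNeg_tsum {Z : ℕ → Ω → ℝ≥0∞} {z : ℕ → ℝ≥0∞}
    (hm : ∀ i, Measurable (Z i)) (hi : iIndepFun Z μ)
    (hz : ∀ i, ∫⁻ ω, expNeg (Z i ω) ∂μ = expNeg (z i)) :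
    ∫⁻ ω, expNeg (∑' i, Z i ω) ∂μ = expNeg (∑' i, z i) := by
  have := hi.isProbabilityMeasure
  have h1 := tendsto_lintegral_expNeg (μ := μ) (Y := fun n ω => ∑ i ∈ Finset.range n, Z i ω)
    (Z := fun ω => ∑' i, Z i ω) (fun n => by fun_prop)
    (Eventually.of_forall fun ω => ENNReal.tendsto_nat_tsum _)
  have h2 := (continuous_expNeg.tendsto _).comp (ENNReal.tendsto_nat_tsum z)
  refine tendsto_nhds_unique h1 (h2.congr fun n => ?_)
  exact (lintegral_expNeg_sum hm hi hz _).symm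

lemma tendsto_tsum_of_monotone {f : ℕ → ℕ → ℝ≥0∞} {g : ℕ → ℝ≥0∞}
    (hmono : ∀ n, Monotone fun m => f m n) (h : ∀ n, Tendsto (fun m => f m n) atTop (𝓝 (g n))) :
    Tendsto (fun m => ∑' n, f m n) atTop (𝓝 (∑' n, g n)) := by
  simp_rw [← lintegral_count]
  exact lintegral_tendsto_of_tendsto_of_monotone (fun m => .of_discrete)
    (Eventually.of_forall hmono) (Eventually.of_forall h)

end Sums

/-! ### The Laplace functional of the Poisson process -/

section Laplace

variable {Ω : Type*} [MeasurableSpace Ω] {μ : Measure Ω} {X : ℕ → Ω → Plane} {lam : ℝ}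

lemma toENNReal_pointCount (x : ℕ → Plane) (B : Set Plane) :
    (pointCount x B : ℝ≥0∞) = ∑' n, B.indicator 1 (x n) := by
  unfold pointCount
  rw [← ENNReal.tsum_set_one, tsum_subtype {n : ℕ | x n ∈ B} (fun _ => (1 : ℝ≥0∞))]
  rfl

lemma measurable_toENNReal_pointCount (hX : ∀ n, Measurable (X n)) {B : Set Plane}
    (hB : MeasurableSet B) :
    Measurable fun ω => (pointCount (fun n => X n ω) B : ℝ≥0∞) := by
  simp_rw [toENNReal_pointCount]
  refine Measurable.tsum fun n => ?_
  exact (measurable_one.indicator hB).comp (hX n)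

lemma lintegral_expNeg_poisson (m : ℝ≥0) (c : ℝ≥0∞) :
    ∫⁻ n : ℕ, expNeg (c * n) ∂(poissonMeasure m) = expNeg (m * (1 - expNeg c)) := by
  obtain ⟨e, he⟩ : ∃ e : ℝ≥0, expNeg c = e := ⟨_, (ENNReal.coe_toNNReal (expNeg_ne_top c)).symm⟩
  have he1 : (e : ℝ) ≤ 1 := by
    have := expNeg_le_one c
    rw [he] at this
    exact_mod_cast this
  have h1 : ∀ n : ℕ, expNeg (c * n) = ENNReal.ofReal ((e : ℝ) ^ n) := fun n => by
    rw [mul_comm, expNeg_nat_mul, he, ENNReal.ofReal_pow e.coe_nonneg, ENNReal.ofReal_coe_nnreal]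
  have h2 : (m : ℝ≥0∞) * (1 - e) = ENNReal.ofReal (m * (1 - e)) := by
    rw [ENNReal.ofReal_mul m.coe_nonneg, ENNReal.ofReal_sub _ e.coe_nonneg]
    simp
  rw [he, h2, expNeg_ofReal (mul_nonneg m.coe_nonneg (by linarith)), poissonMeasure,
    lintegral_sum_measure]
  have h3 : HasSum (fun n : ℕ => Real.exp (-m) * (m : ℝ) ^ n / n.factorial * (e : ℝ) ^ n)
      (Real.exp (-(m * (1 - e)))) := by
    have := (NormedSpace.expSeries_div_hasSum_exp ((m : ℝ) * e)).mul_left (Real.exp (-m))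
    convert! this using 1
    · ext n; rw [mul_pow]; ring
    · rw [← Real.exp_eq_exp_ℝ, ← Real.exp_add]; congr 1; ring
  rw [← h3.tsum_eq, ENNReal.ofReal_tsum_of_nonneg (fun n => by positivity) h3.summable]
  refine tsum_congr fun n => ?_
  rw [lintegral_smul_measure, lintegral_dirac, h1, smul_eq_mul, ENNReal.ofReal_mul (by positivity)]

lemma IsHomogeneousPPP.lintegral_expNeg_pointCount (hX : IsHomogeneousPPP μ X lam) {B : Set Plane}
    (hB : MeasurableSet B) (hfin : volume B ≠ ∞) (c : ℝ≥0∞) :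
    ∫⁻ ω, expNeg (c * (pointCount (fun n => X n ω) B : ℝ≥0∞)) ∂μ =
      expNeg (ENNReal.ofReal lam * volume B * (1 - expNeg c)) := by
  have hl := hX.count_law B hB hfin
  have h1 := lintegral_map' (μ := μ) (f := fun k : ℕ∞ => expNeg (c * (k : ℝ≥0∞)))
    (Measurable.of_discrete).aemeasurable hl.aemeasurable
  rw [← h1, hl.map_eq, lintegral_map .of_discrete .of_discrete]
  simp only [ENat.toENNReal_coe]
  rw [lintegral_expNeg_poisson,
    ENNReal.coe_toNNReal (ENNReal.mul_ne_top ENNReal.ofReal_ne_top hfin)]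

lemma simpleFunc_apply_eq_sum_indicator (φ : SimpleFunc Plane ℝ≥0∞) (x : Plane) :
    φ x = ∑ c ∈ φ.range, c * (φ ⁻¹' {c}).indicator 1 x := by
  rw [Finset.sum_eq_single (φ x)]
  · simp
  · intro c _ hc
    rw [indicator_of_notMem (by simpa using hc.symm), mul_zero]
  · intro h
    exact absurd (SimpleFunc.mem_range_self φ x) h

/-- The Laplace functional for step functions: the level sets are disjoint, so the
numbers of points in them are independent Poisson variables. The level set of `0` may have infinite
area, but does not contribute. -/
lemma IsHomogeneousPPP.laplace_simpleFunc (hX : IsHomogeneousPPP μ X lam)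
    (φ : SimpleFunc Plane ℝ≥0∞) (hfin : ∀ c ≠ 0, volume (φ ⁻¹' {c}) ≠ ∞) :
    ∫⁻ ω, expNeg (∑' n, φ (X n ω)) ∂μ =
      expNeg (ENNReal.ofReal lam * ∫⁻ x, (1 - expNeg (φ x))) := by
  classical
  set e := φ.range.equivFin
  set val : Fin φ.range.card → ℝ≥0∞ := fun i => (e.symm i : ℝ≥0∞)
  have hsum : ∀ g : ℝ≥0∞ → ℝ≥0∞, ∑ c ∈ φ.range, g c = ∑ i, g (val i) := fun g => by
    rw [← Finset.sum_coe_sort, ← e.symm.sum_comp]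
  have hind := hX.count_indep _ (fun i => φ ⁻¹' {val i}) (fun i => φ.measurableSet_preimage _) (by
    intro i j hij
    refine Disjoint.preimage _ (Set.disjoint_singleton.2 fun h => hij ?_)
    exact e.symm.injective (Subtype.ext h))
  have key := lintegral_expNeg_sum (μ := μ)
    (Z := fun i ω => val i * (pointCount (fun n => X n ω) (φ ⁻¹' {val i}) : ℝ≥0∞))
    (z := fun i => ENNReal.ofReal lam * volume (φ ⁻¹' {val i}) * (1 - expNeg (val i)))
    (fun i => (measurable_toENNReal_pointCount hX.measurable
      (φ.measurableSet_preimage _)).const_mul _)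
    (hind.comp (fun i (k : ℕ∞) => val i * (k : ℝ≥0∞)) fun i => .of_discrete)
    (fun i => by
      by_cases h0 : val i = 0
      · have := hind.isProbabilityMeasure
        simp [h0]
      · exact hX.lintegral_expNeg_pointCount (φ.measurableSet_preimage _) (hfin _ h0) _)
    Finset.univ
  have hL : ∀ ω, ∑' n, φ (X n ω) =
      ∑ i, val i * (pointCount (fun n => X n ω) (φ ⁻¹' {val i}) : ℝ≥0∞) := fun ω => by
    simp_rw [simpleFunc_apply_eq_sum_indicator φ (X _ ω), toENNReal_pointCount]
    rw [Summable.tsum_finsetSum (fun _ _ => ENNReal.summable)]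
    simp_rw [ENNReal.tsum_mul_left]
    exact hsum fun c => c * ∑' n, (φ ⁻¹' {c}).indicator 1 (X n ω)
  have hR : ∫⁻ x, (1 - expNeg (φ x)) = ∑ i, volume (φ ⁻¹' {val i}) * (1 - expNeg (val i)) := by
    have h1 := SimpleFunc.lintegral_eq_lintegral (φ.map fun c => 1 - expNeg c) volume
    rw [SimpleFunc.map_lintegral] at h1
    rw [← hsum fun c => volume (φ ⁻¹' {c}) * (1 - expNeg c)]
    simp_rw [mul_comm (volume _)]
    rw [← h1]
    simp
  simp_rw [hL]
  rw [key, hR, Finset.mul_sum]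
  simp_rw [mul_assoc]

/-- The Laplace functional of a homogeneous Poisson process. -/
lemma IsHomogeneousPPP.laplace (hX : IsHomogeneousPPP μ X lam) [IsProbabilityMeasure μ]
    {φ : Plane → ℝ≥0∞} (hφ : Measurable φ) :
    ∫⁻ ω, expNeg (∑' n, φ (X n ω)) ∂μ =
      expNeg (ENNReal.ofReal lam * ∫⁻ x, (1 - expNeg (φ x))) := by
  have hball : ∀ m : ℕ, MeasurableSet (Metric.ball (0 : Plane) m) := fun m =>
    Metric.isOpen_ball.measurableSet
  set s : ℕ → SimpleFunc Plane ℝ≥0∞ := fun m =>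
    (SimpleFunc.eapprox φ m).restrict (Metric.ball (0 : Plane) m)
  have hs : ∀ m x, s m x =
      (Metric.ball (0 : Plane) m).indicator (SimpleFunc.eapprox φ m) x := fun m x => by
    rw [SimpleFunc.restrict_apply _ (hball m)]
  have hmono : ∀ x, Monotone fun m => s m x := fun x m m' h => by
    change s m x ≤ s m' x
    simp only [hs]
    refine (indicator_le_indicator_of_subset (Metric.ball_subset_ball (Nat.cast_le.2 h))
      (fun _ => zero_le) x).trans ?_
    exact indicator_le_indicator (SimpleFunc.monotone_eapprox φ h x)
  have hlim : ∀ x, Tendsto (fun m => s m x) atTop (𝓝 (φ x)) := fun x => by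
    have h1 := SimpleFunc.tendsto_eapprox hφ x
    refine h1.congr' ?_
    obtain ⟨N, hN⟩ := exists_nat_gt ‖x‖
    filter_upwards [eventually_ge_atTop N] with m hm
    rw [hs, indicator_of_mem]
    simp only [Metric.mem_ball, dist_zero_right]
    exact hN.trans_le (by exact_mod_cast hm)
  have hfin : ∀ m, ∀ c ≠ 0, volume (s m ⁻¹' {c}) ≠ ∞ := fun m c hc => by
    refine ne_top_of_le_ne_top (measure_ball_lt_top (x := (0 : Plane)) (r := m)).ne
      (measure_mono fun x hx => ?_)
    by_contra hxm
    have : s m x = c := hx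
    rw [hs, indicator_of_notMem hxm] at this
    exact hc this.symm
  have hA := tendsto_lintegral_expNeg (μ := μ) (Y := fun m ω => ∑' n, s m (X n ω))
    (Z := fun ω => ∑' n, φ (X n ω))
    (fun m => (Measurable.tsum fun n => (s m).measurable.comp (hX.measurable n)).aemeasurable)
    (Eventually.of_forall fun ω => tendsto_tsum_of_monotone (fun n => hmono _) fun n => hlim _)
  have hB : Tendsto (fun m => ∫⁻ x, (1 - expNeg (s m x))) atTop
      (𝓝 (∫⁻ x, (1 - expNeg (φ x)))) := by
    refine lintegral_tendsto_of_tendsto_of_monotone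
      (fun m => (measurable_const.sub (measurable_expNeg.comp (s m).measurable)).aemeasurable)
      (Eventually.of_forall fun x m m' h => tsub_le_tsub_left (antitone_expNeg (hmono x h)) _)
      (Eventually.of_forall fun x => ?_)
    exact ENNReal.Tendsto.sub tendsto_const_nhds ((continuous_expNeg.tendsto _).comp (hlim x))
      (Or.inl ENNReal.one_ne_top)
  have hC := (continuous_expNeg.tendsto _).comp
    (ENNReal.Tendsto.const_mul hB (Or.inr (ENNReal.ofReal_ne_top (r := lam))))
  refine tendsto_nhds_unique hA (hC.congr fun m => ?_)
  exact (hX.laplace_simpleFunc (s m) (hfin m)).symm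

end Laplace

/-! ### An integral representation of the hypergeometric function -/

section Hypergeometric

variable {α : ℝ} {k : ℕ}

lemma integrableOn_mul_rpow_neg (hα : 2 < α) :
    IntegrableOn (fun t : ℝ => t * t ^ (-α)) (Ioi 1) := by
  refine (integrableOn_Ioi_rpow_of_lt (a := 1 - α) (by linarith) one_pos).congr_fun
    (fun t ht => ?_) measurableSet_Ioi
  have ht0 : 0 < t := one_pos.trans ht
  change t ^ (1 - α) = t * t ^ (-α)
  rw [sub_eq_add_neg, Real.rpow_add ht0, Real.rpow_one]

lemma rpow_neg_mem_Ioo (hα : 2 < α) {t : ℝ} (ht : 1 < t) : t ^ (-α) ∈ Ioo (0 : ℝ) 1 :=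
  ⟨Real.rpow_pos_of_pos (one_pos.trans ht) _, Real.rpow_lt_one_of_one_lt_of_neg ht (by linarith)⟩

lemma min_le_norm_one_sub_mul {z : ℂ} {s b : ℝ} (hs : s ∈ Ioo (0 : ℝ) 1) (hz : z.re ≤ b) :
    min 1 (1 - b) ≤ ‖1 - z * (s : ℂ)‖ := by
  refine le_trans ?_ (Complex.re_le_norm _)
  have h1 : (1 - z * (s : ℂ)).re = 1 - z.re * s := by simp
  have h2 : z.re * s ≤ b * s := mul_le_mul_of_nonneg_right hz hs.1.le
  rw [h1]
  rcases le_total b 0 with hb | hb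
  · exact (min_le_left _ _).trans (by nlinarith [hs.1])
  · exact (min_le_right _ _).trans (by nlinarith [hs.2])

/-- The integrand of the representation
`₂F₁(-2/α, k; 1 - 2/α; z) = 1 + ∫ t in (1, ∞), 2 t (1 - (1 - z t ^ (-α)) ^ (-k))`. -/
noncomputable def hypIntegrand (α : ℝ) (k : ℕ) (z : ℂ) (t : ℝ) : ℂ :=
  2 * (t : ℂ) * (1 - (1 - z * ((t ^ (-α) : ℝ) : ℂ))⁻¹ ^ k)

lemma measurable_hypIntegrand (z : ℂ) : Measurable (hypIntegrand α k z) := by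
  unfold hypIntegrand
  fun_prop

lemma integrableOn_hypIntegrand (hα : 2 < α) {z : ℂ} (hz : z.re < 1) :
    IntegrableOn (hypIntegrand α k z) (Ioi 1) := by
  set c := min 1 (1 - z.re)
  have hc : 0 < c := lt_min one_pos (by linarith)
  refine Integrable.mono' ((integrableOn_mul_rpow_neg hα).const_mul
      (2 * (‖z‖ * c⁻¹ * ∑ i ∈ Finset.range k, c⁻¹ ^ i)))
    (measurable_hypIntegrand z).aestronglyMeasurable
    ((ae_restrict_iff' measurableSet_Ioi).2 (Eventually.of_forall fun t (ht : 1 < t) => ?_))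
  have hs := rpow_neg_mem_Ioo hα ht
  set s := t ^ (-α)
  set u : ℂ := 1 - z * (s : ℂ)
  have hu : c ≤ ‖u‖ := min_le_norm_one_sub_mul hs le_rfl
  have hu0 : u ≠ 0 := norm_pos_iff.1 (hc.trans_le hu)
  have hui : ‖u⁻¹‖ ≤ c⁻¹ := by rw [norm_inv]; exact inv_anti₀ hc hu
  have h1 : 1 - u⁻¹ ^ k = -((u⁻¹ - 1) * ∑ i ∈ Finset.range k, u⁻¹ ^ i) := by
    rw [mul_geom_sum]; ring
  have h2 : u⁻¹ - 1 = z * s * u⁻¹ := by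
    rw [show z * (s : ℂ) = 1 - u by simp [u], sub_mul, mul_inv_cancel₀ hu0, one_mul]
  have h3 : ‖∑ i ∈ Finset.range k, u⁻¹ ^ i‖ ≤ ∑ i ∈ Finset.range k, c⁻¹ ^ i := by
    refine (norm_sum_le _ _).trans (Finset.sum_le_sum fun i _ => ?_)
    rw [norm_pow]
    exact pow_le_pow_left₀ (norm_nonneg _) hui i
  change ‖2 * (t : ℂ) * (1 - u⁻¹ ^ k)‖ ≤ _
  rw [h1, h2, norm_mul, norm_neg, norm_mul, norm_mul, norm_mul, norm_mul, Complex.norm_real,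
    Complex.norm_real, Real.norm_of_nonneg hs.1.le, Real.norm_of_nonneg (by linarith : 0 ≤ t),
    Complex.norm_two]
  calc 2 * t * (‖z‖ * s * ‖u⁻¹‖ * ‖∑ i ∈ Finset.range k, u⁻¹ ^ i‖)
      ≤ 2 * t * (‖z‖ * s * c⁻¹ * ∑ i ∈ Finset.range k, c⁻¹ ^ i) := by
        have := hs.1
        gcongr
    _ = _ := by ring

/-- On a half-plane `re z < b < 1` the derivative of the integrand is dominated by a multiple of
`t ^ (1 - α)`. -/
lemma differentiableAt_integral_hypIntegrand (hα : 2 < α) {z : ℂ} (hz : z.re < 1) :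
    DifferentiableAt ℂ (fun z => ∫ t in Ioi (1 : ℝ), hypIntegrand α k z t) z := by
  set b := (1 + z.re) / 2
  set c := min 1 (1 - b)
  have hb : b < 1 := by simp only [b]; linarith
  have hc : 0 < c := lt_min one_pos (by linarith)
  have hopen : IsOpen {w : ℂ | w.re < b} := isOpen_lt Complex.continuous_re continuous_const
  refine (hasDerivAt_integral_of_dominated_loc_of_deriv_le
    (F' := fun w t => 2 * (t : ℂ) * -(k * (1 - w * ((t ^ (-α) : ℝ) : ℂ))⁻¹ ^ (k - 1) *
      (((t ^ (-α) : ℝ) : ℂ) / (1 - w * ((t ^ (-α) : ℝ) : ℂ)) ^ 2)))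
    (bound := fun t => 2 * (k * c⁻¹ ^ (k - 1) * (c⁻¹ ^ 2)) * (t * t ^ (-α)))
    (hopen.mem_nhds (show z.re < b by simp only [b]; linarith))
    (Eventually.of_forall fun w => (measurable_hypIntegrand w).aestronglyMeasurable)
    (integrableOn_hypIntegrand hα hz) (Measurable.aestronglyMeasurable (by fun_prop))
    ((ae_restrict_iff' measurableSet_Ioi).2 (Eventually.of_forall fun t (ht : 1 < t) w hw => ?_))
    ((integrableOn_mul_rpow_neg hα).const_mul _)
    ((ae_restrict_iff' measurableSet_Ioi).2
      (Eventually.of_forall fun t (ht : 1 < t) w hw => ?_))).2.differentiableAt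
  · have hs := rpow_neg_mem_Ioo hα ht
    have hu : c ≤ ‖1 - w * ((t ^ (-α) : ℝ) : ℂ)‖ := min_le_norm_one_sub_mul hs (le_of_lt hw)
    set s := t ^ (-α)
    set u : ℂ := 1 - w * (s : ℂ)
    have hui : ‖u⁻¹‖ ≤ c⁻¹ := by rw [norm_inv]; exact inv_anti₀ hc hu
    rw [div_eq_mul_inv, ← inv_pow]
    simp only [norm_mul, norm_neg, norm_pow, Complex.norm_real, Real.norm_of_nonneg hs.1.le,
      Real.norm_of_nonneg (by linarith : 0 ≤ t), Complex.norm_two, Complex.norm_natCast]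
    calc 2 * t * (k * ‖u⁻¹‖ ^ (k - 1) * (s * ‖u⁻¹‖ ^ 2))
        ≤ 2 * t * (k * c⁻¹ ^ (k - 1) * (s * c⁻¹ ^ 2)) := by
          have := hs.1
          gcongr
      _ = _ := by ring
  · have hs := rpow_neg_mem_Ioo hα ht
    have hu : c ≤ ‖1 - w * ((t ^ (-α) : ℝ) : ℂ)‖ := min_le_norm_one_sub_mul hs (le_of_lt hw)
    have hu0 := norm_pos_iff.1 (hc.trans_le hu)
    unfold hypIntegrand
    have h1 : HasDerivAt (fun w : ℂ => 1 - w * ((t ^ (-α) : ℝ) : ℂ))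
        (-((t ^ (-α) : ℝ) : ℂ)) w := by
      simpa using ((hasDerivAt_id w).mul_const ((t ^ (-α) : ℝ) : ℂ)).const_sub 1
    have h2 := ((h1.inv hu0).pow k).const_sub 1
    simpa using h2.const_mul (2 * (t : ℂ))

/-- The excess over `1` of the hypergeometric function `₂F₁(-2/α, k; 1 - 2/α; x)`. -/
noncomputable def hypExcess (α : ℝ) (k : ℕ) (x : ℝ) : ℝ :=
  ∫ t in Ioi (1 : ℝ), 2 * t * (1 - (1 - x * t ^ (-α))⁻¹ ^ k)

lemma ofReal_hypIntegrand (x t : ℝ) :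
    ((2 * t * (1 - (1 - x * t ^ (-α))⁻¹ ^ k) : ℝ) : ℂ) = hypIntegrand α k x t := by
  simp [hypIntegrand]

lemma hypExcess_eq_re (x : ℝ) :
    hypExcess α k x = (∫ t in Ioi (1 : ℝ), hypIntegrand α k x t).re := by
  simp_rw [← ofReal_hypIntegrand]
  rw [integral_complex_ofReal, Complex.ofReal_re]
  rfl

lemma integrableOn_hypExcess (hα : 2 < α) {x : ℝ} (hx : x < 1) :
    IntegrableOn (fun t => 2 * t * (1 - (1 - x * t ^ (-α))⁻¹ ^ k)) (Ioi 1) := by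
  have h := (integrableOn_hypIntegrand (k := k) hα (z := x) (by simpa using hx)).re
  refine h.congr (Eventually.of_forall fun t => ?_)
  change (hypIntegrand α k x t).re = _
  rw [← ofReal_hypIntegrand, Complex.ofReal_re]

lemma analyticOnNhd_hypExcess (hα : 2 < α) :
    AnalyticOnNhd ℝ (fun x => 1 + hypExcess α k x) (Iio 1) := by
  intro x hx
  simp_rw [hypExcess_eq_re]
  refine analyticAt_const.add (AnalyticAt.re_ofReal
    (f := fun z => ∫ t in Ioi (1 : ℝ), hypIntegrand α k z t) ?_)
  have hopen : IsOpen {w : ℂ | w.re < 1} := isOpen_lt Complex.continuous_re continuous_const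
  refine DifferentiableOn.analyticAt (s := {w : ℂ | w.re < 1})
    (fun w hw => (differentiableAt_integral_hypIntegrand hα hw).differentiableWithinAt)
    (hopen.mem_nhds (by simpa using hx))

lemma ascPochhammer_eval_mul_add (a : ℝ) (n : ℕ) :
    (ascPochhammer ℝ n).eval a * (a + n) = a * (ascPochhammer ℝ n).eval (a + 1) := by
  induction n with
  | zero => simp
  | succ n ih =>
    rw [ascPochhammer_succ_eval, ascPochhammer_succ_eval, ih]
    push_cast
    ring

/-- The coefficients of the hypergeometric series with parameters `-δ`, `j + 1`, `1 - δ`. -/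
lemma hypergeometric_coeff {δ : ℝ} (hδ0 : 0 < δ) (hδ : δ < 1) (j n : ℕ) :
    ((n.factorial : ℝ)⁻¹ * (ascPochhammer ℝ n).eval (-δ) *
      (ascPochhammer ℝ n).eval ((j + 1 : ℕ) : ℝ) * ((ascPochhammer ℝ n).eval (1 - δ))⁻¹) =
      ((n + j).choose j : ℝ) * (-δ / (n - δ)) := by
  have hpos : 0 < (ascPochhammer ℝ n).eval (1 - δ) := ascPochhammer_pos n _ (by linarith)
  have h1 : (ascPochhammer ℝ n).eval ((j + 1 : ℕ) : ℝ) = n.factorial * ((n + j).choose j : ℝ) := by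
    rw [← ascPochhammer_eval_cast, ascPochhammer_nat_eq_ascFactorial,
      Nat.ascFactorial_eq_factorial_mul_choose, Nat.cast_mul, add_comm j n,
      Nat.choose_symm_add]
  have hn : (n : ℝ) - δ ≠ 0 := by
    rcases Nat.eq_zero_or_pos n with rfl | h
    · simpa using hδ0.ne'
    · have : (1 : ℝ) ≤ n := by exact_mod_cast h
      linarith
  have h2 := ascPochhammer_eval_mul_add (-δ) n
  rw [show -δ + 1 = 1 - δ by ring, show -δ + (n : ℝ) = n - δ by ring] at h2
  have h3 : (ascPochhammer ℝ n).eval (-δ) =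
      -δ / (n - δ) * (ascPochhammer ℝ n).eval (1 - δ) := by
    rw [div_mul_eq_mul_div, eq_div_iff hn, h2]
  have hf : (n.factorial : ℝ) ≠ 0 := by exact_mod_cast n.factorial_ne_zero
  rw [h1, h3]
  field_simp

/-- Term by term integration of the binomial series of `(1 - x t ^ (-α)) ^ (-(j + 1))`. -/
lemma hasSum_hypExcess (hα : 2 < α) (j : ℕ) {x : ℝ} (hx : |x| < 1) :
    HasSum (fun n : ℕ => ((n + 1 + j).choose j : ℝ) *
      (-(2 / α) / ((n + 1 : ℕ) - 2 / α)) * x ^ (n + 1)) (hypExcess α (j + 1) x) := by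
  have hα0 : 0 < α := by linarith
  set C : ℕ → ℝ := fun n => ((n + 1 + j).choose j : ℝ)
  set F : ℕ → ℝ → ℝ := fun n t => (-2 * (C n * x ^ (n + 1))) * t ^ (1 - α * (n + 1))
  have hexp : ∀ n : ℕ, 1 - α * ((n : ℝ) + 1) < -1 := fun n => by
    have : (0 : ℝ) ≤ n := n.cast_nonneg
    nlinarith
  have hintpow : ∀ n : ℕ, ∫ t in Ioi (1 : ℝ), t ^ (1 - α * ((n : ℝ) + 1)) =
      1 / (α * (n + 1) - 2) := fun n => by
    rw [integral_Ioi_rpow_of_lt (hexp n) one_pos, Real.one_rpow,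
      show 1 - α * ((n : ℝ) + 1) + 1 = -(α * (n + 1) - 2) by ring, neg_div_neg_eq]
  have hFint : ∀ n, Integrable (F n) (volume.restrict (Ioi 1)) := fun n =>
    (integrableOn_Ioi_rpow_of_lt (hexp n) one_pos).const_mul _
  have hgeom := hasSum_choose_mul_geometric_of_norm_lt_one (𝕜 := ℝ) j
    (r := |x|) (by simpa using hx)
  have hsummC : Summable fun n => C n * |x| ^ (n + 1) :=
    (summable_nat_add_iff (f := fun n => ((n + j).choose j : ℝ) * |x| ^ n) 1).2 hgeom.summable
  have hnorm : ∀ n, ∫ t in Ioi (1 : ℝ), ‖F n t‖ = 2 * (C n * |x| ^ (n + 1)) *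
      (1 / (α * (n + 1) - 2)) := fun n => by
    rw [← hintpow, ← integral_const_mul]
    refine setIntegral_congr_fun measurableSet_Ioi fun t (ht : 1 < t) => ?_
    have ht0 : 0 ≤ t := by linarith
    change ‖(-2 * (C n * x ^ (n + 1))) * t ^ (1 - α * (n + 1))‖ = _
    rw [norm_mul, Real.norm_of_nonneg (Real.rpow_nonneg ht0 _), norm_mul, norm_mul, norm_pow,
      Real.norm_of_nonneg (show 0 ≤ C n from Nat.cast_nonneg _), Real.norm_eq_abs x]
    norm_num
  have hsumm : Summable fun n => ∫ t in Ioi (1 : ℝ), ‖F n t‖ := by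
    simp_rw [hnorm]
    refine Summable.of_nonneg_of_le (fun n => ?_) (fun n => ?_) (hsummC.mul_left (2 / (α - 2)))
    · have : 0 ≤ α * ((n : ℝ) + 1) - 2 := by linarith [hexp n]
      have : 0 ≤ C n := Nat.cast_nonneg _
      positivity
    · have h0 : (0 : ℝ) ≤ n := n.cast_nonneg
      have h1 : α - 2 ≤ α * ((n : ℝ) + 1) - 2 := by nlinarith
      have h2 : 1 / (α * ((n : ℝ) + 1) - 2) ≤ 1 / (α - 2) :=
        one_div_le_one_div_of_le (by linarith) h1
      have : 0 ≤ 2 * (C n * |x| ^ (n + 1)) := by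
        have : 0 ≤ C n := Nat.cast_nonneg _
        positivity
      calc _ ≤ 2 * (C n * |x| ^ (n + 1)) * (1 / (α - 2)) := mul_le_mul_of_nonneg_left h2 this
        _ = _ := by ring
  have hmain := hasSum_integral_of_summable_integral_norm hFint hsumm
  have hval : ∫ t in Ioi (1 : ℝ), ∑' n, F n t = hypExcess α (j + 1) x := by
    refine setIntegral_congr_fun measurableSet_Ioi fun t (ht : 1 < t) => ?_
    have ht0 : 0 < t := by linarith
    have hs := rpow_neg_mem_Ioo hα ht
    have hy : ‖x * t ^ (-α)‖ < 1 := by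
      rw [norm_mul, Real.norm_of_nonneg hs.1.le, Real.norm_eq_abs]
      nlinarith [abs_nonneg x, hs.1, hs.2]
    have h1 := hasSum_choose_mul_geometric_of_norm_lt_one (𝕜 := ℝ) j hy
    have h2 := ((hasSum_nat_add_iff' 1).2 h1).mul_left (-2 * t)
    simp only [Finset.range_one, Finset.sum_singleton, zero_add, Nat.choose_self, Nat.cast_one,
      pow_zero, mul_one] at h2
    have h3 : (fun n => F n t) = fun n => -2 * t *
        (((n + 1 + j).choose j : ℝ) * (x * t ^ (-α)) ^ (n + 1)) := by
      funext n
      have : t ^ (1 - α * ((n : ℝ) + 1)) = t * (t ^ (-α)) ^ (n + 1) := by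
        rw [← Real.rpow_natCast, ← Real.rpow_mul ht0.le, sub_eq_add_neg, Real.rpow_add ht0,
          Real.rpow_one]
        push_cast
        ring_nf
      simp only [F, C]
      rw [this, mul_pow]
      ring
    change ∑' n, F n t = _
    rw [h3, h2.tsum_eq, one_div, inv_pow]
    ring
  rw [hval] at hmain
  convert! hmain using 1
  funext n
  simp only [F, C]
  rw [integral_const_mul, hintpow]
  have h0 : α * ((n : ℝ) + 1) - 2 ≠ 0 := by linarith [hexp n]
  have h1 : ((n + 1 : ℕ) : ℝ) - 2 / α ≠ 0 := by
    push_cast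
    intro h
    apply h0
    field_simp at h
    linarith
  push_cast at h1 ⊢
  rw [show (n : ℝ) + 1 - 2 / α = (α * (n + 1) - 2) / α by field_simp]
  field_simp

/-- For `k = 0` both sides are `1`, the series because `(0)_n = 0` for `n ≥ 1`; otherwise the
representation is integrated term by term near `0`. -/
lemma isHypContinuation_hypExcess (hα : 2 < α) (k : ℕ) :
    IsHypContinuation (-2 / α) k (1 - 2 / α) (fun x => 1 + hypExcess α k x) := by
  refine ⟨analyticOnNhd_hypExcess hα, ?_⟩
  have hα0 : 0 < α := by linarith
  filter_upwards [Metric.ball_mem_nhds (0 : ℝ) one_pos] with x hx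
  have hx1 : |x| < 1 := by simpa using hx
  rw [ordinaryHypergeometric_eq_tsum]
  beta_reduce
  rcases k with _ | j
  · rw [tsum_eq_single 0]
    · simp [hypExcess]
    · intro n hn
      simp [ascPochhammer_ne_zero_eval_zero ℝ hn]
  · have h1 := (hasSum_hypExcess hα j hx1)
    have hc := hypergeometric_coeff (δ := 2 / α) (by positivity) ((div_lt_one hα0).2 hα) j
    simp_rw [smul_eq_mul, neg_div, hc]
    have h2 : HasSum (fun n : ℕ => ((n + j).choose j : ℝ) * (-(2 / α) / (n - 2 / α)) * x ^ n)
        (1 + hypExcess α (j + 1) x) := by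
      rw [← hasSum_nat_add_iff' 1]
      convert! h1 using 1
      have : α ≠ 0 := hα0.ne'
      simp
      field_simp
      ring
    exact h2.tsum_eq.symm

lemma hyp2F1_eq_one_add_hypExcess (hα : 2 < α) (k : ℕ) {x : ℝ} (hx : x < 1) :
    hyp2F1 (-2 / α) k (1 - 2 / α) x = 1 + hypExcess α k x :=
  hyp2F1_eq (isHypContinuation_hypExcess hα k) hx

end Hypergeometric

/-! ### The nearest point of the Poisson process -/

section Nearest

/-- Conditions on `w` under which the functional `∏ n, (1 - w (s / ‖X n‖))` of a Poisson process
is handled below. -/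
structure IsProfile (w : ℝ → ℝ) : Prop where
  continuous : Continuous w
  monotone : Monotone w
  map_zero : w 0 = 0
  lt_one : ∀ x, w x < 1
  integrableOn : ∀ s, 0 ≤ s → IntegrableOn (fun r => r * w (s / r)) (Ioi 0)

variable {w : ℝ → ℝ} {lam : ℝ}

/-- The exponent `-log (1 - w (s / r))` that a point at distance `r` contributes to
`∏ n, (1 - w (s / ‖X n‖))`. -/
noncomputable def attenuation (w : ℝ → ℝ) (s r : ℝ) : ℝ≥0∞ :=
  ENNReal.ofReal (-Real.log (1 - w (s / r)))

/-- The mean number, divided by `2 π lam`, of points removed when all points within distance `a` of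
the origin, and each farther point with probability `w (s / r)`, are removed. -/
noncomputable def meanRemoved (w : ℝ → ℝ) (s a : ℝ) : ℝ :=
  a ^ 2 / 2 + ∫ r in Ioi a, r * w (s / r)

/-- The density of the distance of the nearest point under the weight
`∏ n, (1 - w (s / ‖X n‖))`. -/
noncomputable def nearestDensity (w : ℝ → ℝ) (lam s r : ℝ) : ℝ :=
  2 * Real.pi * lam * (r * (1 - w (s / r))) * Real.exp (-(2 * Real.pi * lam * meanRemoved w s r))

lemma IsProfile.nonneg (hw : IsProfile w) {x : ℝ} (hx : 0 ≤ x) : 0 ≤ w x :=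
  hw.map_zero ▸ hw.monotone hx

lemma IsProfile.measurable_attenuation (hw : IsProfile w) :
    Measurable fun q : ℝ × ℝ => attenuation w q.1 q.2 := by
  have := hw.continuous.measurable
  unfold attenuation
  fun_prop

lemma IsProfile.expNeg_attenuation (hw : IsProfile w) {s r : ℝ} (hs : 0 ≤ s) (hr : 0 ≤ r) :
    expNeg (attenuation w s r) = ENNReal.ofReal (1 - w (s / r)) :=
  expNeg_ofReal_neg_log (by linarith [hw.lt_one (s / r)])
    (by linarith [hw.nonneg (div_nonneg hs hr)])

lemma IsProfile.attenuation_mono (hw : IsProfile w) {s s' r : ℝ} (hs : s ≤ s') (hr : 0 ≤ r) :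
    attenuation w s r ≤ attenuation w s' r := by
  refine ENNReal.ofReal_le_ofReal (neg_le_neg (Real.log_le_log ?_ ?_))
  · linarith [hw.lt_one (s' / r)]
  · have := hw.monotone (div_le_div_of_nonneg_right hs hr)
    linarith

lemma IsProfile.continuous_attenuation (hw : IsProfile w) (r : ℝ) :
    Continuous fun s => attenuation w s r := by
  unfold attenuation
  refine ENNReal.continuous_ofReal.comp (Continuous.neg (Continuous.log ?_ fun s => ?_))
  · exact continuous_const.sub (hw.continuous.comp (continuous_id.div_const r))
  · linarith [hw.lt_one (s / r)]

lemma integrable_radial_and_integral {u : ℝ → ℝ} (hu : IntegrableOn (fun r => r * u r) (Ioi 0)) :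
    Integrable (fun x : Plane => u ‖x‖) ∧
      ∫ x : Plane, u ‖x‖ = 2 * Real.pi * ∫ r in Ioi 0, r * u r := by
  have hd : Module.finrank ℝ Plane = 2 := by simp [Plane]
  have hv : (volume : Measure Plane).real (Metric.ball 0 1) = Real.pi := by
    rw [measureReal_def, EuclideanSpace.volume_ball_fin_two]
    simp [Real.pi_pos.le]
  constructor
  · have := (integrable_fun_norm_addHaar (volume : Measure Plane) (f := u)).2
    rw [hd] at this
    exact this (by simpa using hu)
  · rw [integral_fun_norm_addHaar (volume : Measure Plane) u, hd, hv]
    simp [mul_assoc]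

section Tail

variable {Ω : Type*} [MeasurableSpace Ω] {μ : Measure Ω} [IsProbabilityMeasure μ]
  {X : ℕ → Ω → Plane}

lemma le_iInf_norm_iff (x : ℕ → Plane) (a : ℝ) : a ≤ ⨅ n, ‖x n‖ ↔ ∀ n, a ≤ ‖x n‖ :=
  le_ciInf_iff ⟨0, by rintro _ ⟨n, rfl⟩; exact norm_nonneg _⟩

lemma iInf_norm_nonneg (x : ℕ → Plane) : 0 ≤ ⨅ n, ‖x n‖ :=
  (le_iInf_norm_iff x 0).2 fun _ => norm_nonneg _

/-- The event that no point lies within distance `a` is absorbed into the Laplace functional by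
giving these points the exponent `∞`. -/
lemma IsHomogeneousPPP.lintegral_tail (hX : IsHomogeneousPPP μ X lam) (hlam : 0 < lam)
    (hw : IsProfile w) {s a : ℝ} (hs : 0 ≤ s) (ha : 0 ≤ a) :
    ∫⁻ ω in {ω | a ≤ ⨅ n, ‖X n ω‖}, expNeg (∑' n, attenuation w s ‖X n ω‖) ∂μ =
      ENNReal.ofReal (Real.exp (-(2 * Real.pi * lam * meanRemoved w s a))) := by
  classical
  have hmeas := hX.measurable
  set ψ : Plane → ℝ≥0∞ := fun x => if ‖x‖ < a then ⊤ else attenuation w s ‖x‖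
  have hball : MeasurableSet {x : Plane | ‖x‖ < a} := measurableSet_lt (by fun_prop) (by fun_prop)
  have hψ : Measurable ψ := Measurable.ite hball measurable_const
    (hw.measurable_attenuation.comp (measurable_const.prodMk measurable_norm))
  have hset : MeasurableSet {ω | a ≤ ⨅ n, ‖X n ω‖} :=
    measurableSet_le measurable_const (Measurable.iInf fun n => by fun_prop)
  have h1 : ∫⁻ ω in {ω | a ≤ ⨅ n, ‖X n ω‖}, expNeg (∑' n, attenuation w s ‖X n ω‖) ∂μ =
      ∫⁻ ω, expNeg (∑' n, ψ (X n ω)) ∂μ := by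
    rw [← lintegral_indicator hset]
    refine lintegral_congr fun ω => ?_
    by_cases h : a ≤ ⨅ n, ‖X n ω‖
    · rw [indicator_of_mem (by exact h)]
      rw [le_iInf_norm_iff] at h
      simp only [ψ, (h _).not_gt, if_false]
    · rw [indicator_of_notMem (by exact h)]
      rw [le_iInf_norm_iff] at h
      push Not at h
      obtain ⟨n, hn⟩ := h
      have : ∑' n, ψ (X n ω) = ⊤ := ENNReal.tsum_eq_top_of_eq_top ⟨n, by simp [ψ, hn]⟩
      rw [this, expNeg_top]
  set u : ℝ → ℝ := fun r => if r < a then 1 else w (s / r)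
  have hu : ∀ r, 0 ≤ r → 0 ≤ u r := fun r hr => by
    simp only [u]
    split_ifs
    · exact zero_le_one
    · exact hw.nonneg (div_nonneg hs hr)
  have h2 : ∀ x, 1 - expNeg (ψ x) = ENNReal.ofReal (u ‖x‖) := fun x => by
    by_cases hx : ‖x‖ < a
    · simp [ψ, u, hx]
    · simp only [ψ, u, hx, if_false]
      rw [hw.expNeg_attenuation hs (norm_nonneg _), ← ENNReal.ofReal_one,
        ← ENNReal.ofReal_sub _ (by linarith [hw.lt_one (s / ‖x‖)])]
      congr 1
      ring
  have hsplit : Ioi (0 : ℝ) = Ioc 0 a ∪ Ioi a := (Ioc_union_Ioi_eq_Ioi ha).symm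
  have hae : ∀ᵐ r : ℝ ∂volume.restrict (Ioc 0 a), r * u r = r := by
    rw [ae_restrict_iff' measurableSet_Ioc]
    filter_upwards [Measure.ae_ne volume a] with r hr hra
    have : r < a := lt_of_le_of_ne hra.2 hr
    simp [u, this]
  have hright : EqOn (fun r => r * w (s / r)) (fun r => r * u r) (Ioi a) := fun r (hr : a < r) => by
    simp [u, hr.not_gt]
  have hiw := (hw.integrableOn s hs).mono_set (Ioi_subset_Ioi ha)
  have hleft : IntegrableOn (fun r : ℝ => r) (Ioc 0 a) :=
    (continuous_id.integrableOn_Icc).mono_set Ioc_subset_Icc_self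
  have hi1 : IntegrableOn (fun r => r * u r) (Ioc 0 a) :=
    hleft.congr (hae.mono fun r hr => hr.symm)
  have hi2 : IntegrableOn (fun r => r * u r) (Ioi a) := hiw.congr_fun hright measurableSet_Ioi
  have hui : IntegrableOn (fun r => r * u r) (Ioi 0) := by
    rw [hsplit]; exact hi1.union hi2
  obtain ⟨hint, hval⟩ := integrable_radial_and_integral hui
  have h3 : ∫ r in Ioi 0, r * u r = meanRemoved w s a := by
    rw [hsplit, setIntegral_union (Ioc_disjoint_Ioi le_rfl) measurableSet_Ioi hi1 hi2,
      integral_congr_ae hae, ← setIntegral_congr_fun measurableSet_Ioi hright,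
      ← intervalIntegral.integral_of_le ha, integral_id]
    simp [meanRemoved]
  have h4 : 0 ≤ meanRemoved w s a := by
    rw [← h3]
    exact setIntegral_nonneg measurableSet_Ioi fun r (hr : 0 < r) => mul_nonneg hr.le (hu r hr.le)
  rw [h1, hX.laplace hψ]
  simp_rw [h2]
  rw [← ofReal_integral_eq_lintegral_ofReal hint
    (Eventually.of_forall fun x => hu _ (norm_nonneg _)), hval, h3,
    ← ENNReal.ofReal_mul hlam.le, expNeg_ofReal (by have := Real.pi_pos; positivity)]
  congr 3
  ring

end Tail

lemma IsProfile.meanRemoved_ge (hw : IsProfile w) {s a : ℝ} (hs : 0 ≤ s) (ha : 0 ≤ a) :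
    a ^ 2 / 2 ≤ meanRemoved w s a := by
  have : 0 ≤ ∫ r in Ioi a, r * w (s / r) :=
    setIntegral_nonneg measurableSet_Ioi fun r (hr : a < r) =>
      mul_nonneg (ha.trans hr.le) (hw.nonneg (div_nonneg hs (ha.trans hr.le)))
  unfold meanRemoved
  linarith

lemma IsProfile.nearestDensity_nonneg (hw : IsProfile w) (hlam : 0 < lam) {s r : ℝ} (hr : 0 ≤ r) :
    0 ≤ nearestDensity w lam s r := by
  have h1 : 0 ≤ 1 - w (s / r) := by linarith [hw.lt_one (s / r)]
  have := Real.pi_pos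
  unfold nearestDensity
  positivity

/-- The density integrates to the tail, being minus its derivative. -/
lemma IsProfile.integral_nearestDensity (hw : IsProfile w) (hlam : 0 < lam) {s a : ℝ} (hs : 0 ≤ s)
    (ha : 0 ≤ a) :
    IntegrableOn (nearestDensity w lam s) (Ioi a) ∧
      ∫ r in Ioi a, nearestDensity w lam s r =
        Real.exp (-(2 * Real.pi * lam * meanRemoved w s a)) := by
  have hpi := Real.pi_pos
  have hcw : Continuous w := hw.continuous
  set q : ℝ → ℝ := (Ioi 0).indicator fun r => r * w (s / r)
  have hq : Integrable q := (integrable_indicator_iff measurableSet_Ioi).2 (hw.integrableOn s hs)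
  set M : ℝ → ℝ := fun b => b ^ 2 / 2 + ((∫ r in Ioi a, q r) - ∫ r in a..b, q r)
  have hM : ∀ b, a ≤ b → M b = meanRemoved w s b := fun b hb => by
    simp only [M, meanRemoved]
    congr 1
    rw [← intervalIntegral.integral_interval_add_Ioi hq.integrableOn hq.integrableOn (b := b),
      add_sub_cancel_left]
    refine setIntegral_congr_fun measurableSet_Ioi fun r (hr : b < r) => ?_
    exact indicator_of_mem (show r ∈ Ioi (0 : ℝ) from (ha.trans hb).trans_lt hr) _
  have hMc : Continuous M := by
    have := intervalIntegral.continuous_primitive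
      (fun x y => hq.intervalIntegrable (a := x) (b := y)) a
    fun_prop
  have hMd : ∀ b ∈ Ioi a, HasDerivAt M (b * (1 - w (s / b))) b := fun b (hb : a < b) => by
    have hb0 : 0 < b := ha.trans_lt hb
    have hev : q =ᶠ[𝓝 b] fun r => r * w (s / r) := by
      filter_upwards [Ioi_mem_nhds hb0] with r hr
      exact indicator_of_mem hr _
    have hc : ContinuousAt q b := by
      refine ContinuousAt.congr ?_ hev.symm
      exact continuousAt_id.mul
        (hcw.continuousAt.comp (continuousAt_const.div continuousAt_id hb0.ne'))
    have h1 := intervalIntegral.integral_hasDerivAt_right (hq.intervalIntegrable (a := a) (b := b))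
      hq.aestronglyMeasurable.stronglyMeasurableAtFilter hc
    have h2 := (((hasDerivAt_id b).pow 2).div_const 2).add
      ((hasDerivAt_const b (∫ r in Ioi a, q r)).sub h1)
    refine h2.congr_deriv ?_
    rw [hev.eq_of_nhds]
    simp
    ring
  set g : ℝ → ℝ := fun b => -Real.exp (-(2 * Real.pi * lam * M b))
  have hgc : Continuous g := by fun_prop
  have hgd : ∀ b ∈ Ioi a, HasDerivAt g (nearestDensity w lam s b) b := fun b hb => by
    have := (((hMd b hb).const_mul (2 * Real.pi * lam)).neg.exp).neg
    refine this.congr_deriv ?_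
    simp only [Pi.neg_apply]
    rw [hM b (le_of_lt hb)]
    unfold nearestDensity
    ring
  have hlim : Tendsto g atTop (𝓝 0) := by
    rw [← neg_zero]
    refine Tendsto.neg (Real.tendsto_exp_atBot.comp ?_)
    refine tendsto_neg_atTop_atBot.comp ?_
    refine Tendsto.const_mul_atTop (by positivity) ?_
    refine tendsto_atTop_mono' _ (f₁ := fun b : ℝ => b ^ 2 / 2) ?_
      ((tendsto_pow_atTop two_ne_zero).atTop_div_const two_pos)
    filter_upwards [eventually_ge_atTop a] with b hb
    rw [hM b hb]
    exact hw.meanRemoved_ge hs (ha.trans hb)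
  have hint := integrableOn_Ioi_deriv_of_nonneg hgc.continuousWithinAt hgd
    (fun b (hb : a < b) => hw.nearestDensity_nonneg hlam (ha.trans hb.le)) hlim
  refine ⟨hint, ?_⟩
  rw [integral_Ioi_of_hasDerivAt_of_tendsto hgc.continuousWithinAt hgd hint hlim]
  simp only [g, hM a le_rfl]
  ring

section Law

variable {Ω : Type*} [MeasurableSpace Ω] {μ : Measure Ω} [IsProbabilityMeasure μ]
  {X : ℕ → Ω → Plane}

lemma IsProfile.measurable_tsum_attenuation (hw : IsProfile w) (hX : ∀ n, Measurable (X n))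
    {S : Ω → ℝ} (hS : Measurable S) :
    Measurable fun ω => ∑' n, attenuation w (S ω) ‖X n ω‖ :=
  Measurable.tsum fun n => hw.measurable_attenuation.comp (hS.prodMk (hX n).norm)

/-- For a fixed scale `s`, the law of the nearest distance under the weight
`∏ n, (1 - w (s / ‖X n‖))`. -/
lemma IsHomogeneousPPP.lintegral_nearest_fixed (hX : IsHomogeneousPPP μ X lam) (hlam : 0 < lam)
    (hw : IsProfile w) {s : ℝ} (hs : 0 ≤ s) {f : ℝ → ℝ≥0∞} (hf : Measurable f) :
    ∫⁻ ω, expNeg (∑' n, attenuation w s ‖X n ω‖) * f (⨅ n, ‖X n ω‖) ∂μ =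
      ∫⁻ r in Ioi 0, ENNReal.ofReal (nearestDensity w lam s r) * f r := by
  have hmeas := hX.measurable
  have hR : Measurable fun ω => ⨅ n, ‖X n ω‖ := Measurable.iInf fun n => by fun_prop
  have hV : Measurable fun ω => expNeg (∑' n, attenuation w s ‖X n ω‖) :=
    measurable_expNeg.comp (hw.measurable_tsum_attenuation hmeas measurable_const)
  have hd : AEMeasurable (fun r => ENNReal.ofReal (nearestDensity w lam s r))
      (volume.restrict (Ioi 0)) :=
    (hw.integral_nearestDensity hlam hs le_rfl).1.aemeasurable.ennreal_ofReal
  have : IsFiniteMeasure (μ.withDensity fun ω => expNeg (∑' n, attenuation w s ‖X n ω‖)) := by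
    refine isFiniteMeasure_withDensity (ne_top_of_le_ne_top ENNReal.one_ne_top ?_)
    refine (lintegral_mono fun ω => expNeg_le_one _).trans ?_
    simp
  have hlaw : (μ.withDensity fun ω => expNeg (∑' n, attenuation w s ‖X n ω‖)).map
      (fun ω => ⨅ n, ‖X n ω‖) =
      (volume.restrict (Ioi 0)).withDensity fun r => ENNReal.ofReal (nearestDensity w lam s r) := by
    refine Measure.ext_of_Ici _ _ fun a => ?_
    rw [Measure.map_apply hR measurableSet_Ici, withDensity_apply _ (hR measurableSet_Ici),
      withDensity_apply _ measurableSet_Ici, Measure.restrict_restrict measurableSet_Ici]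
    have h1 : (fun ω => ⨅ n, ‖X n ω‖) ⁻¹' Ici a = {ω | max a 0 ≤ ⨅ n, ‖X n ω‖} := by
      ext ω
      simp [iInf_norm_nonneg]
    have h2 : (Ici a ∩ Ioi 0 : Set ℝ) =ᵐ[volume] Ioi (max a 0) := by
      rw [show Ioi (max a 0) = Ioi a ∩ Ioi 0 from Ioi_inter_Ioi.symm]
      exact Ioi_ae_eq_Ici.symm.inter (ae_eq_refl _)
    have h3 := hw.integral_nearestDensity hlam hs (le_max_right a 0)
    rw [h1, hX.lintegral_tail hlam hw hs (le_max_right a 0), Measure.restrict_congr_set h2,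
      ← h3.2, ofReal_integral_eq_lintegral_ofReal h3.1]
    refine (ae_restrict_iff' measurableSet_Ioi).2 (Eventually.of_forall fun r hr => ?_)
    exact hw.nearestDensity_nonneg hlam ((le_max_right a 0).trans (le_of_lt hr))
  refine (lintegral_withDensity_eq_lintegral_mul μ hV (hf.comp hR)).symm.trans ?_
  simp only [Function.comp_def]
  rw [← lintegral_map hf hR, hlaw, lintegral_withDensity_eq_lintegral_mul₀ hd hf.aemeasurable]
  rfl

/-- The dyadic approximation of `r` from below. -/
noncomputable def dyadicFloor (m : ℕ) (r : ℝ) : ℝ := ⌊r * 2 ^ m⌋₊ / 2 ^ m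

lemma measurable_dyadicFloor (m : ℕ) : Measurable (dyadicFloor m) := by
  unfold dyadicFloor
  fun_prop

lemma dyadicFloor_nonneg (m : ℕ) (r : ℝ) : 0 ≤ dyadicFloor m r := by
  unfold dyadicFloor
  positivity

lemma dyadicFloor_le (m : ℕ) {r : ℝ} (hr : 0 ≤ r) : dyadicFloor m r ≤ r := by
  unfold dyadicFloor
  rw [div_le_iff₀ (by positivity)]
  exact Nat.floor_le (by positivity)

lemma monotone_dyadicFloor {r : ℝ} (hr : 0 ≤ r) : Monotone fun m => dyadicFloor m r := by
  refine monotone_nat_of_le_succ fun m => ?_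
  unfold dyadicFloor
  rw [div_le_div_iff₀ (by positivity) (by positivity), pow_succ, mul_left_comm, ← mul_assoc,
    mul_comm (2 ^ m) (_ : ℝ)]
  have h : ((⌊r * 2 ^ m⌋₊ * 2 : ℕ) : ℝ) ≤ ⌊r * (2 ^ m * 2)⌋₊ := by
    refine Nat.cast_le.2 (Nat.le_floor ?_)
    push_cast
    have := Nat.floor_le (show 0 ≤ r * 2 ^ m by positivity)
    linarith
  push_cast at h
  nlinarith [pow_pos (two_pos : (0 : ℝ) < 2) m]

lemma tendsto_dyadicFloor {r : ℝ} (hr : 0 ≤ r) :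
    Tendsto (fun m => dyadicFloor m r) atTop (𝓝 r) :=
  (tendsto_nat_floor_mul_div_atTop hr).comp (tendsto_pow_atTop_atTop_of_one_lt one_lt_two)

/-- The law of the nearest distance under the weight `∏ n, (1 - w (s / ‖X n‖))`, where `s` is the
dyadic approximation of the nearest distance. -/
lemma IsHomogeneousPPP.lintegral_nearest_dyadic (hX : IsHomogeneousPPP μ X lam) (hlam : 0 < lam)
    (hw : IsProfile w) (m : ℕ) {f : ℝ → ℝ≥0∞} (hf : Measurable f) :
    AEMeasurable (fun r => ENNReal.ofReal (nearestDensity w lam (dyadicFloor m r) r) * f r)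
        (volume.restrict (Ioi 0)) ∧
    ∫⁻ ω, expNeg (∑' n, attenuation w (dyadicFloor m (⨅ n, ‖X n ω‖)) ‖X n ω‖) *
        f (⨅ n, ‖X n ω‖) ∂μ =
      ∫⁻ r in Ioi 0, ENNReal.ofReal (nearestDensity w lam (dyadicFloor m r) r) * f r := by
  have hmeas := hX.measurable
  have hR : Measurable fun ω => ⨅ n, ‖X n ω‖ := Measurable.iInf fun n => by fun_prop
  set cell : ℕ → Set ℝ := fun j => {r | ⌊r * 2 ^ m⌋₊ = j}
  have hcell : ∀ j, MeasurableSet (cell j) := fun j =>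
    (show Measurable fun r : ℝ => ⌊r * 2 ^ m⌋₊ by fun_prop) (measurableSet_singleton j)
  have hfj : ∀ j, Measurable ((cell j).indicator f) := fun j => hf.indicator (hcell j)
  have hsplit : ∀ (g : ℝ → ℝ≥0∞) (r : ℝ), g (dyadicFloor m r) * f r =
      ∑' j : ℕ, g (j / 2 ^ m) * (cell j).indicator f r := fun g r => by
    rw [tsum_eq_single ⌊r * 2 ^ m⌋₊]
    · rw [indicator_of_mem (show r ∈ cell _ from rfl)]
      rfl
    · intro j hj
      rw [indicator_of_notMem (show r ∉ cell j from fun h => hj h.symm), mul_zero]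
  have hd : ∀ j : ℕ, AEMeasurable (fun r => ENNReal.ofReal (nearestDensity w lam (j / 2 ^ m) r) *
      (cell j).indicator f r) (volume.restrict (Ioi 0)) := fun j =>
    ((hw.integral_nearestDensity hlam (by positivity) le_rfl).1.aemeasurable.ennreal_ofReal).mul
      (hfj j).aemeasurable
  have hdens : (fun r => ENNReal.ofReal (nearestDensity w lam (dyadicFloor m r) r) * f r) =
      fun r => ∑' j : ℕ, ENNReal.ofReal (nearestDensity w lam (j / 2 ^ m) r) *
        (cell j).indicator f r := by
    funext r
    exact hsplit (fun s => ENNReal.ofReal (nearestDensity w lam s r)) r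
  rw [hdens]
  refine ⟨AEMeasurable.tsum hd, ?_⟩
  rw [lintegral_tsum hd]
  simp_rw [fun ω => hsplit (fun s => expNeg (∑' n, attenuation w s ‖X n ω‖)) (⨅ n, ‖X n ω‖)]
  have hZ : ∀ j : ℕ, Measurable fun ω => expNeg (∑' n, attenuation w (j / 2 ^ m) ‖X n ω‖) *
      (cell j).indicator f (⨅ n, ‖X n ω‖) := fun j =>
    (measurable_expNeg.comp (hw.measurable_tsum_attenuation hmeas measurable_const)).mul
      ((hfj j).comp hR)
  rw [lintegral_tsum fun j => (hZ j).aemeasurable]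
  refine tsum_congr fun j => ?_
  exact hX.lintegral_nearest_fixed hlam hw (by positivity) (hfj j)

/-- The law of the nearest distance `R` under the weight `∏ n, (1 - w (R / ‖X n‖))`, in which the
scale is `R` itself. -/
lemma IsHomogeneousPPP.lintegral_nearest (hX : IsHomogeneousPPP μ X lam) (hlam : 0 < lam)
    (hw : IsProfile w) {f : ℝ → ℝ≥0∞} (hf : Measurable f) (hf1 : ∀ r, f r ≤ 1) :
    ∫⁻ ω, expNeg (∑' n, attenuation w (⨅ n, ‖X n ω‖) ‖X n ω‖) * f (⨅ n, ‖X n ω‖) ∂μ =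
      ∫⁻ r in Ioi 0, ENNReal.ofReal (nearestDensity w lam r r) * f r := by
  have hmeas := hX.measurable
  have hpi := Real.pi_pos
  have hft : ∀ r, f r ≠ ⊤ := fun r => ne_top_of_le_ne_top ENNReal.one_ne_top (hf1 r)
  have hR : Measurable fun ω => ⨅ n, ‖X n ω‖ := Measurable.iInf fun n => by fun_prop
  have hL : Tendsto (fun m => ∫⁻ ω,
      expNeg (∑' n, attenuation w (dyadicFloor m (⨅ n, ‖X n ω‖)) ‖X n ω‖) *
        f (⨅ n, ‖X n ω‖) ∂μ) atTop
      (𝓝 (∫⁻ ω, expNeg (∑' n, attenuation w (⨅ n, ‖X n ω‖) ‖X n ω‖) *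
        f (⨅ n, ‖X n ω‖) ∂μ)) := by
    refine tendsto_lintegral_of_dominated_convergence (fun _ => 1) (fun m => ?_)
      (fun m => Eventually.of_forall fun ω => mul_le_one' (expNeg_le_one _) (hf1 _)) (by simp)
      (Eventually.of_forall fun ω => ?_)
    · exact (measurable_expNeg.comp (hw.measurable_tsum_attenuation hmeas
        ((measurable_dyadicFloor m).comp hR))).mul (hf.comp hR)
    · have hR0 := iInf_norm_nonneg fun n => X n ω
      refine ENNReal.Tendsto.mul_const ?_ (Or.inr (hft _))
      -- The approximations increase, so no bound on the sums of the exponents is needed.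
      refine (continuous_expNeg.tendsto _).comp (tendsto_tsum_of_monotone (fun n m m' h => ?_)
        fun n => ?_)
      · exact hw.attenuation_mono (monotone_dyadicFloor hR0 h) (norm_nonneg _)
      · exact ((hw.continuous_attenuation _).tendsto _).comp (tendsto_dyadicFloor hR0)
  have hbound : IntegrableOn
      (fun r => 2 * Real.pi * lam * (r * Real.exp (-(Real.pi * lam) * r ^ 2))) (Ioi 0) :=
    ((integrable_mul_exp_neg_mul_sq (b := Real.pi * lam) (by positivity)).const_mul _).integrableOn
  have hRR : Tendsto (fun m => ∫⁻ r in Ioi 0,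
      ENNReal.ofReal (nearestDensity w lam (dyadicFloor m r) r) * f r) atTop
      (𝓝 (∫⁻ r in Ioi 0, ENNReal.ofReal (nearestDensity w lam r r) * f r)) := by
    refine tendsto_lintegral_of_dominated_convergence'
      (fun r => ENNReal.ofReal (2 * Real.pi * lam * (r * Real.exp (-(Real.pi * lam) * r ^ 2))))
      (fun m => (hX.lintegral_nearest_dyadic hlam hw m hf).1)
      (fun m => (ae_restrict_iff' measurableSet_Ioi).2
        (Eventually.of_forall fun r (hr : 0 < r) => ?_))
      hbound.lintegral_lt_top.ne
      ((ae_restrict_iff' measurableSet_Ioi).2 (Eventually.of_forall fun r (hr : 0 < r) => ?_))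
    · refine (mul_le_of_le_one_right' (hf1 r)).trans (ENNReal.ofReal_le_ofReal ?_)
      unfold nearestDensity
      rw [mul_assoc _ (r * _) _]
      have h0 := hw.nonneg (div_nonneg (dyadicFloor_nonneg m r) hr.le)
      have h1 := hw.lt_one (dyadicFloor m r / r)
      have h2 := hw.meanRemoved_ge (dyadicFloor_nonneg m r) hr.le
      refine mul_le_mul_of_nonneg_left (mul_le_mul ?_ (Real.exp_le_exp.2 ?_)
        (Real.exp_pos _).le hr.le) (by positivity)
      · nlinarith
      · have := mul_le_mul_of_nonneg_left h2 (show 0 ≤ 2 * Real.pi * lam by positivity)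
        linarith
    · refine ENNReal.Tendsto.mul_const ((ENNReal.continuous_ofReal.tendsto _).comp ?_)
        (Or.inr (hft _))
      have hfl := tendsto_dyadicFloor hr.le
      have hcont : ∀ x, Tendsto (fun m => w (dyadicFloor m r / x)) atTop (𝓝 (w (r / x))) :=
        fun x => (hw.continuous.tendsto _).comp (hfl.div_const x)
      have hH : Tendsto (fun m => ∫ x in Ioi r, x * w (dyadicFloor m r / x)) atTop
          (𝓝 (∫ x in Ioi r, x * w (r / x))) := by
        refine tendsto_integral_of_dominated_convergence (fun x => x * w (r / x)) (fun m => ?_)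
          ((hw.integrableOn r hr.le).mono_set (Ioi_subset_Ioi hr.le)) (fun m =>
            (ae_restrict_iff' measurableSet_Ioi).2 (Eventually.of_forall fun x (hx : r < x) => ?_))
          (Eventually.of_forall fun x => (hcont x).const_mul x)
        · have := hw.continuous.measurable
          exact Measurable.aestronglyMeasurable (by fun_prop)
        · have hx0 : 0 < x := hr.trans hx
          have h0 := hw.nonneg (div_nonneg (dyadicFloor_nonneg m r) hx0.le)
          rw [Real.norm_of_nonneg (mul_nonneg hx0.le h0)]
          exact mul_le_mul_of_nonneg_left
            (hw.monotone (div_le_div_of_nonneg_right (dyadicFloor_le m hr.le) hx0.le)) hx0.le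
      unfold nearestDensity meanRemoved
      refine Tendsto.mul ((((hcont r).const_sub 1).const_mul r).const_mul _)
        ((Real.continuous_exp.tendsto _).comp ?_)
      exact ((hH.const_add _).const_mul _).neg
  exact tendsto_nhds_unique hL (hRR.congr fun m =>
    (hX.lintegral_nearest_dyadic hlam hw m hf).2.symm)

end Law

end Nearest

/-! ### Coverage in one slot -/

section ExponentialVariables

lemma expMeasure_one_lt_ofReal (y : ℝ≥0∞) :
    expMeasure 1 {z : ℝ | y < ENNReal.ofReal z} = expNeg y := by
  have := isProbabilityMeasure_expMeasure one_pos
  rcases eq_or_ne y ⊤ with rfl | hy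
  · simp
  · lift y to ℝ≥0 using hy
    have h1 : {z : ℝ | (y : ℝ≥0∞) < ENNReal.ofReal z} = (Iic (y : ℝ))ᶜ := by
      ext z
      simp [ENNReal.lt_ofReal_iff_toReal_lt]
    rw [h1, measure_compl measurableSet_Iic (measure_ne_top _ _), measure_univ,
      ← ENNReal.ofReal_coe_nnreal, expNeg_ofReal y.coe_nonneg,
      ← ofReal_measureReal, ← cdf_eq_real, cdf_expMeasure_eq one_pos, if_pos y.coe_nonneg,
      ← ENNReal.ofReal_one, ← ENNReal.ofReal_sub _ (by simp), one_mul]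
    congr 1
    ring

/-- The Laplace transform of the exponential distribution: tilting turns the density of rate `1`
into a multiple of the density of rate `1 + c`. -/
lemma lintegral_expNeg_mul_expMeasure {c : ℝ} (hc : 0 ≤ c) :
    ∫⁻ z, expNeg (ENNReal.ofReal c * ENNReal.ofReal z) ∂(expMeasure 1) =
      expNeg (ENNReal.ofReal (Real.log (1 + c))) := by
  have h1c : 0 < 1 + c := by linarith
  have hdens : ∀ z : ℝ, gammaPDF 1 1 z * expNeg (ENNReal.ofReal c * ENNReal.ofReal z) =
      ENNReal.ofReal (1 + c)⁻¹ * exponentialPDF (1 + c) z := fun z => by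
    change exponentialPDF 1 z * _ = _
    rcases lt_or_ge z 0 with hz | hz
    · simp [exponentialPDF_of_neg hz]
    · rw [exponentialPDF_of_nonneg hz, exponentialPDF_of_nonneg hz, ← ENNReal.ofReal_mul hc,
        expNeg_ofReal (mul_nonneg hc hz), ← ENNReal.ofReal_mul (by positivity),
        ← ENNReal.ofReal_mul (by positivity), ← mul_assoc, inv_mul_cancel₀ h1c.ne', mul_assoc,
        ← Real.exp_add]
      congr 3
      ring
  rw [expMeasure, gammaMeasure,
    lintegral_withDensity_eq_lintegral_mul _ (by unfold gammaPDF; fun_prop) (by fun_prop)]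
  simp only [Pi.mul_apply, hdens]
  rw [lintegral_const_mul' _ _ ENNReal.ofReal_ne_top, lintegral_exponentialPDF_eq_one h1c, mul_one,
    expNeg_ofReal (Real.log_nonneg (by linarith)), Real.exp_neg, Real.exp_log h1c]

lemma measurable_const_add_tsum {Ω' : Type*} {m : MeasurableSpace Ω'} {f : ℕ → Ω' → ℝ≥0∞}
    (hf : ∀ n, Measurable (f n)) (b : ℝ≥0∞) : Measurable fun ω => b + ∑' n, f n ω :=
  (Measurable.tsum hf).const_add b

variable {Ω' : Type*} [MeasurableSpace Ω'] {ν : Measure Ω'}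

/-- The probability that one exponential variable exceeds a constant plus a weighted sum of others
is, by independence, a Laplace transform. -/
lemma measure_add_tsum_lt {g : ℕ → Ω' → ℝ} (hm : ∀ n, Measurable (g n))
    (hl : ∀ n, HasLaw (g n) (expMeasure 1) ν) (hi : iIndepFun g ν) {c : ℕ → ℝ}
    (hc : ∀ n, 0 ≤ c n) {s : ℕ} (hs : c s = 0) (b : ℝ≥0∞) :
    ν {ω | b + ∑' n, ENNReal.ofReal (c n) * ENNReal.ofReal (g n ω) < ENNReal.ofReal (g s ω)} =
      expNeg b * expNeg (∑' n, ENNReal.ofReal (Real.log (1 + c n))) := by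
  have := hi.isProbabilityMeasure
  set Y : Ω' → ℝ≥0∞ := fun ω => b + ∑' n, ENNReal.ofReal (c n) * ENNReal.ofReal (g n ω)
  have hY : Measurable Y := by fun_prop
  have hind : IndepFun Y (g s) ν := by
    have h1 := indep_iSup_of_disjoint (m := fun n => MeasurableSpace.comap (g n) inferInstance)
      (fun n => (hm n).comap_le) hi.iIndep (S := {s}ᶜ) (T := {s}) disjoint_compl_left
    refine (IndepFun_iff_Indep _ _ _).2 (indep_of_indep_of_le_right
      (indep_of_indep_of_le_left h1 ?_) ?_)
    · rw [← measurable_iff_comap_le]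
      refine measurable_const_add_tsum (fun n => ?_) b
      by_cases hn : n = s
      · subst hn
        simp [hs]
      · have h2 : Measurable[MeasurableSpace.comap (g n) inferInstance] (g n) :=
          comap_measurable _
        have h3 : Measurable[⨆ i ∈ ({s}ᶜ : Set ℕ),
            MeasurableSpace.comap (g i) inferInstance] (g n) :=
          h2.mono (le_iSup₂_of_le n hn le_rfl) le_rfl
        exact (show Measurable fun z : ℝ => ENNReal.ofReal (c n) * ENNReal.ofReal z by
          fun_prop).comp h3
    · exact le_iSup₂_of_le s rfl le_rfl
  have hmap := (indepFun_iff_map_prod_eq_prod_map_map hY.aemeasurable (hm s).aemeasurable).1 hind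
  have hset : MeasurableSet {q : ℝ≥0∞ × ℝ | q.1 < ENNReal.ofReal q.2} :=
    measurableSet_lt (by fun_prop) (by fun_prop)
  have h1 : ν {ω | Y ω < ENNReal.ofReal (g s ω)} = ∫⁻ ω, expNeg (Y ω) ∂ν := by
    have h2 := Measure.map_apply (μ := ν) (hY.prodMk (hm s)) hset
    have : IsProbabilityMeasure (ν.map (g s)) :=
      Measure.isProbabilityMeasure_map (hm s).aemeasurable
    rw [hmap, Measure.prod_apply hset] at h2
    change ν ((fun ω => (Y ω, g s ω)) ⁻¹' {q : ℝ≥0∞ × ℝ | q.1 < ENNReal.ofReal q.2}) = _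
    rw [← h2, ← lintegral_map measurable_expNeg hY, (hl s).map_eq]
    exact lintegral_congr fun y => expMeasure_one_lt_ofReal y
  rw [h1]
  simp_rw [Y, expNeg_add]
  rw [lintegral_const_mul' _ _ (expNeg_ne_top b)]
  congr 1
  refine lintegral_expNeg_tsum (fun n => by fun_prop)
    (hi.comp (fun n z => ENNReal.ofReal (c n) * ENNReal.ofReal z) fun n => by fun_prop) fun n => ?_
  rw [← lintegral_expNeg_mul_expMeasure (hc n), ← (hl n).map_eq,
    lintegral_map (by fun_prop) (hm n)]

end ExponentialVariables

namespace Params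

variable (p : Params)

lemma pathLoss_pos {r : ℝ} (hr : 0 < r) : 0 < p.pathLoss r :=
  mul_pos p.K_pos (Real.rpow_pos_of_pos hr _)

open Classical in
/-- The function `𝓖` with a strict threshold in the criterion that involves the ASNR, as in the
definition of coverage. It differs from `calG` at one distance at most. -/
noncomputable def strictG : Criterion → ℝ → ℝ
  | .sir, _ => 1
  | .sinr, r => Real.exp (-(p.γ * p.W * p.K * r ^ p.α / p.P))
  | .sirAsnr, r => if r < (p.P / (p.K * p.W * p.θ)) ^ (1 / p.α) then 1 else 0

/-- The weight `γ ℓ(r₀) / ℓ(rₙ)` of an interfering station, and `0` for any other one. -/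
noncomputable def interferenceWeight (x : ℕ → Plane) (a : ℕ → Bool) (n : ℕ) : ℝ :=
  if n ≠ p.serving x ∧ a n = true then p.γ * (‖x (p.serving x)‖ / ‖x n‖) ^ p.α else 0

/-- The probability, over the fading, of coverage in one slot. -/
noncomputable def coverProb (c : Criterion) (x : ℕ → Plane) (a : ℕ → Bool) : ℝ≥0∞ :=
  ENNReal.ofReal (p.strictG c ‖x (p.serving x)‖) *
    expNeg (∑' n, ENNReal.ofReal (Real.log (1 + p.interferenceWeight x a n)))

lemma interferenceWeight_nonneg (x : ℕ → Plane) (a : ℕ → Bool) (n : ℕ) :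
    0 ≤ p.interferenceWeight x a n := by
  unfold interferenceWeight
  have := p.γ_pos
  split_ifs <;> positivity

/-- The conventions `S / 0 = ∞` for `S ≠ 0`, `0 / 0 = 0` and `S / ∞ = 0` do not matter for a strict
inequality with a positive finite threshold. -/
lemma lt_div_iff_of_ofReal_pos {γ : ℝ} (hγ : 0 < γ) (S I : ℝ≥0∞) :
    ENNReal.ofReal γ < S / I ↔ ENNReal.ofReal γ * I < S := by
  have h0 : ENNReal.ofReal γ ≠ 0 := by simpa using hγ
  rcases eq_or_ne I 0 with rfl | hI
  · rcases eq_or_ne S 0 with rfl | hS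
    · simp
    · simp [ENNReal.div_zero hS, pos_iff_ne_zero, hS]
  rcases eq_or_ne I ⊤ with rfl | hI'
  · simp [ENNReal.mul_top h0]
  · exact ENNReal.lt_div_iff_mul_lt (Or.inl hI) (Or.inl hI')

/-- The threshold condition in terms of the fading coefficients. -/
lemma lt_signal_div_iff {x : ℕ → Plane} (hx : ∀ n, x n ≠ 0) (a : ℕ → Bool) (g : ℕ → ℝ)
    (b : ℝ≥0∞) :
    ENNReal.ofReal p.γ < p.signal x g / (p.interference x a g + b) ↔
      ENNReal.ofReal (p.γ * p.pathLoss ‖x (p.serving x)‖ / p.P) * b +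
        ∑' n, ENNReal.ofReal (p.interferenceWeight x a n) * ENNReal.ofReal (g n) <
      ENNReal.ofReal (g (p.serving x)) := by
  have hP := p.P_pos
  have hγ := p.γ_pos
  have hK := p.K_pos
  have hl : ∀ n, 0 < p.pathLoss ‖x n‖ := fun n => p.pathLoss_pos (norm_pos_iff.2 (hx n))
  set l0 := p.pathLoss ‖x (p.serving x)‖
  have hl0 : 0 < l0 := hl _
  have hrec : ∀ n, p.receivedPower (x n) (g n) =
      ENNReal.ofReal (p.P / p.pathLoss ‖x n‖) * ENNReal.ofReal (g n) := fun n => by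
    rw [receivedPower, ← ENNReal.ofReal_div_of_pos (hl n),
      ← ENNReal.ofReal_mul (div_pos hP (hl n)).le]
    congr 1
    ring
  -- Multiplication by `ℓ(r₀) / P` isolates the fading coefficient of the serving station.
  set M := ENNReal.ofReal (l0 / p.P)
  have hM0 : M ≠ 0 := by simpa [M] using div_pos hl0 hP
  have hMS : M * p.signal x g = ENNReal.ofReal (g (p.serving x)) := by
    rw [signal, hrec, ← mul_assoc, ← ENNReal.ofReal_mul (by positivity)]
    change ENNReal.ofReal (l0 / p.P * (p.P / l0)) * _ = _
    rw [div_mul_div_cancel₀ hP.ne', div_self hl0.ne', ENNReal.ofReal_one, one_mul]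
  have hI : M * (ENNReal.ofReal p.γ * p.interference x a g) =
      ∑' n, ENNReal.ofReal (p.interferenceWeight x a n) * ENNReal.ofReal (g n) := by
    rw [interference, tsum_subtype (p.interferers x a) (fun n => p.receivedPower (x n) (g n)),
      ← ENNReal.tsum_mul_left, ← ENNReal.tsum_mul_left]
    refine tsum_congr fun n => ?_
    by_cases hn : n ≠ p.serving x ∧ a n = true
    · rw [indicator_of_mem (show n ∈ p.interferers x a from hn), hrec, interferenceWeight,
        if_pos hn, ← mul_assoc, ← mul_assoc, ← ENNReal.ofReal_mul (by positivity),
        ← ENNReal.ofReal_mul (by positivity)]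
      congr 2
      have h1 : (0 : ℝ) < ‖x n‖ ^ p.α := Real.rpow_pos_of_pos (norm_pos_iff.2 (hx n)) _
      rw [Real.div_rpow (norm_nonneg _) (norm_nonneg _)]
      simp only [l0, pathLoss]
      field_simp
    · rw [indicator_of_notMem (show n ∉ p.interferers x a from hn), interferenceWeight, if_neg hn]
      simp
  rw [lt_div_iff_of_ofReal_pos hγ, ← ENNReal.mul_lt_mul_iff_right hM0 ENNReal.ofReal_ne_top, hMS,
    mul_add, mul_add, hI, ← mul_assoc, ← ENNReal.ofReal_mul (by positivity), add_comm,
    div_mul_eq_mul_div, mul_comm l0]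

lemma asnr_iff {x : ℕ → Plane} (hx : x (p.serving x) ≠ 0) :
    ENNReal.ofReal p.θ < p.ASNR x ↔
      ‖x (p.serving x)‖ < (p.P / (p.K * p.W * p.θ)) ^ (1 / p.α) := by
  have hP := p.P_pos
  have hθ := p.θ_pos
  have hK := p.K_pos
  have hW := p.W_pos
  have hα := p.two_lt_α
  have hr := norm_pos_iff.2 hx
  have hl := p.pathLoss_pos hr
  have hWl : 0 < p.W * p.pathLoss ‖x (p.serving x)‖ := mul_pos hW hl
  rw [ASNR, ← ENNReal.ofReal_div_of_pos hWl, ENNReal.ofReal_lt_ofReal_iff (div_pos hP hWl),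
    lt_div_iff₀ hWl, one_div, Real.lt_rpow_inv_iff_of_pos hr.le (by positivity) (by linarith),
    lt_div_iff₀ (by positivity), pathLoss]
  ring_nf

variable {Ω' : Type*} [MeasurableSpace Ω'] {ν : Measure Ω'}

lemma measure_covered (c : Criterion) {x : ℕ → Plane} (hx : ∀ n, x n ≠ 0) (a : ℕ → Bool)
    {g : ℕ → Ω' → ℝ} (hm : ∀ n, Measurable (g n))
    (hl : ∀ n, HasLaw (g n) (expMeasure 1) ν) (hi : iIndepFun g ν) :
    ν {ω | p.Covered c x a fun n => g n ω} = p.coverProb c x a := by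
  have hP := p.P_pos
  have hγ := p.γ_pos
  have hW := p.W_pos
  have hs : p.interferenceWeight x a (p.serving x) = 0 := by simp [interferenceWeight]
  have key := fun b => measure_add_tsum_lt hm hl hi (p.interferenceWeight_nonneg x a) hs b
  have hsir : ν {ω | ENNReal.ofReal p.γ < p.SIR x a fun n => g n ω} =
      expNeg (∑' n, ENNReal.ofReal (Real.log (1 + p.interferenceWeight x a n))) := by
    have h1 := fun ω => p.lt_signal_div_iff hx a (fun n => g n ω) 0
    simp only [add_zero, mul_zero] at h1
    simp only [SIR, h1]
    rw [key 0, expNeg_zero, one_mul]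
  cases c with
  | sir =>
    simp only [Covered, coverProb, strictG]
    rw [hsir, ENNReal.ofReal_one, one_mul]
  | sinr =>
    simp only [Covered, coverProb, strictG, SINR, p.lt_signal_div_iff hx]
    rw [key, ← ENNReal.ofReal_mul (by have := p.pathLoss_pos (norm_pos_iff.2 (hx (p.serving x)));
                                      positivity),
      expNeg_ofReal (by have := p.pathLoss_pos (norm_pos_iff.2 (hx (p.serving x))); positivity)]
    congr 3
    rw [pathLoss]
    ring_nf
  | sirAsnr =>
    simp only [Covered, coverProb, strictG, p.asnr_iff (hx _)]
    by_cases h : ‖x (p.serving x)‖ < (p.P / (p.K * p.W * p.θ)) ^ (1 / p.α)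
    · simp only [h, and_true, if_true]
      rw [hsir, ENNReal.ofReal_one, one_mul]
    · simp only [h, and_false, if_false]
      simp

/-! ### The delay -/

lemma lt_delay_iff (c : Criterion) (x : ℕ → Plane) (a : ℕ → Bool) (g : ℕ → ℕ → ℝ) (τ : ℕ) :
    (τ : ℕ∞) < p.delay c x a g ↔ ∀ t ∈ Finset.Icc 1 τ, ¬ p.Covered c x a (g t) := by
  rw [delay, ← ENat.add_one_le_iff (by simp)]
  simp only [le_iInf_iff, Finset.mem_Icc]
  refine forall_congr' fun t => ⟨fun h ht hc => ?_, fun h ht => ?_⟩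
  · have := h ⟨ht.1, hc⟩
    norm_cast at this
    omega
  · by_contra hlt
    refine h ⟨ht.1, ?_⟩ ht.2
    norm_cast at hlt
    omega

lemma measurableSet_covered (c : Criterion) (x : ℕ → Plane) (a : ℕ → Bool) :
    MeasurableSet {g : ℕ → ℝ | p.Covered c x a g} := by
  have hr : ∀ n, Measurable fun g : ℕ → ℝ => p.receivedPower (x n) (g n) := fun n => by
    unfold receivedPower
    fun_prop
  have hS : Measurable (p.signal x) := hr _
  have hI : Measurable (p.interference x a) := Measurable.tsum fun n => hr n
  cases c with
  | sir => exact measurableSet_lt measurable_const (hS.div hI)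
  | sinr => exact measurableSet_lt measurable_const (hS.div (hI.add_const _))
  | sirAsnr =>
    exact (measurableSet_lt measurable_const (hS.div hI)).inter (MeasurableSet.const _)

end Params

section Slots

variable {Ω' : Type*} [MeasurableSpace Ω'] {ν : Measure Ω'} {h : ℕ → ℕ → Ω' → ℝ}

lemma IsRayleighFading.iIndepFun_slot (hfad : IsRayleighFading ν h) (t : ℕ) :
    iIndepFun (h t) ν :=
  hfad.indep.precomp (g := fun n : ℕ => (t, n)) (Prod.mk_right_injective t)

/-- The fading vectors of different slots are independent. -/
lemma IsRayleighFading.iIndepFun_slots (hfad : IsRayleighFading ν h) :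
    iIndepFun (fun t ω n => h t n ω) ν := by
  have := hfad.indep.isProbabilityMeasure
  have hm := hfad.measurable
  have hp : ∀ t n, IsProbabilityMeasure (ν.map (h t n)) :=
    fun t n => Measure.isProbabilityMeasure_map (hm t n).aemeasurable
  rw [iIndepFun_iff_map_fun_eq_infinitePi_map (by fun_prop)]
  have h1 := hfad.indep.map_fun_eq_infinitePi_map
    (fun q : ℕ × ℕ => hm q.1 q.2)
  have h2 : ∀ t, ν.map (fun ω n => h t n ω) = Measure.infinitePi fun n => ν.map (h t n) := fun t =>
    (hfad.iIndepFun_slot t).map_fun_eq_infinitePi_map (hm t)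
  simp_rw [h2]
  rw [← Measure.infinitePi_map_curry (fun t n => ν.map (h t n)), ← h1,
    Measure.map_map (MeasurableEquiv.measurable _) (by fun_prop)]
  rfl

lemma Params.condDelayCCDF_eq (p : Params) (hfad : IsRayleighFading ν h) (c : Criterion)
    {x : ℕ → Plane} (hx : ∀ n, x n ≠ 0) (a : ℕ → Bool) (τ : ℕ) :
    p.condDelayCCDF ν h c x a τ = (1 - (p.coverProb c x a).toReal) ^ τ := by
  have := hfad.indep.isProbabilityMeasure
  have hE := p.measurableSet_covered c x a
  have hm := hfad.measurable
  have h1 : {ω | (τ : ℕ∞) < p.delay c x a fun t n => h t n ω} =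
      ⋂ t ∈ Finset.Icc 1 τ, (fun ω n => h t n ω) ⁻¹' {g | p.Covered c x a g}ᶜ := by
    ext ω
    simp [p.lt_delay_iff]
  have h2 : ∀ t, ν ((fun ω n => h t n ω) ⁻¹' {g | p.Covered c x a g}ᶜ) =
      1 - p.coverProb c x a := fun t => by
    rw [preimage_compl, measure_compl ((show Measurable fun ω n => h t n ω by fun_prop) hE)
      (measure_ne_top _ _), measure_univ]
    congr 1
    exact p.measure_covered c hx a (hm t) (hfad.law t) (hfad.iIndepFun_slot t)
  have h3 : p.coverProb c x a ≤ 1 := by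
    rw [← p.measure_covered c hx a (hm 0) (hfad.law 0) (hfad.iIndepFun_slot 0)]
    exact prob_le_one
  rw [condDelayCCDF, measureReal_def, h1,
    hfad.iIndepFun_slots.measure_inter_preimage_eq_mul _ fun _ _ => hE.compl]
  simp only [h2, Finset.prod_const, Nat.card_Icc, Nat.add_sub_cancel, ENNReal.toReal_pow,
    ENNReal.toReal_sub_of_le h3 ENNReal.one_ne_top, ENNReal.toReal_one]

end Slots

/-! ### The moments of the coverage probability -/

namespace Params

variable (p : Params)

lemma activeProb_pos : 0 < p.activeProb := by
  have h := p.lamBS_pos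
  have h' := p.lamMT_pos
  have h1 : 1 < 1 + p.lamMT / (3.5 * p.lamBS) := by
    have : 0 < p.lamMT / (3.5 * p.lamBS) := by positivity
    linarith
  have := Real.rpow_lt_one_of_one_lt_of_neg h1 (show (-3.5 : ℝ) < 0 by norm_num)
  unfold activeProb
  linarith

lemma activeProb_lt_one : p.activeProb < 1 := by
  have h := p.lamBS_pos
  have h' := p.lamMT_pos
  have : 0 < (1 + p.lamMT / (3.5 * p.lamBS)) ^ (-3.5 : ℝ) := by positivity
  unfold activeProb
  linarith

/-- The mean factor by which a station at distance `r` reduces the `k`-th moment of the coverage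
probability is `1 - p.coverProfile k (r₀ / r)`. The argument is truncated at `0` so that the
function is monotone on the whole line. -/
noncomputable def coverProfile (k : ℕ) (x : ℝ) : ℝ :=
  p.activeProb * (1 - (1 + p.γ * max x 0 ^ p.α)⁻¹ ^ k)

lemma calF_eq (k : ℕ) : p.calF k = 1 + p.activeProb * hypExcess p.α k (-p.γ) := by
  rw [calF, hyp2F1_eq_one_add_hypExcess p.two_lt_α k (by linarith [p.γ_pos])]
  ring

lemma one_le_calF (k : ℕ) : 1 ≤ p.calF k := by
  have hγ := p.γ_pos
  have h : 0 ≤ hypExcess p.α k (-p.γ) := by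
    refine setIntegral_nonneg measurableSet_Ioi fun t (ht : 1 < t) => ?_
    have h1 := (rpow_neg_mem_Ioo p.two_lt_α ht).1
    have h2 : (1 - -p.γ * t ^ (-p.α))⁻¹ ≤ 1 := inv_le_one_of_one_le₀ (by nlinarith)
    have h3 : (0 : ℝ) ≤ (1 - -p.γ * t ^ (-p.α))⁻¹ := inv_nonneg.2 (by nlinarith)
    have := pow_le_one₀ (n := k) h3 h2
    have h4 : 0 ≤ 1 - (1 - -p.γ * t ^ (-p.α))⁻¹ ^ k := by linarith
    have h5 : 0 ≤ t := by linarith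
    positivity
  rw [calF_eq]
  nlinarith [p.activeProb_pos]

lemma coverProfile_scaled (k : ℕ) {s t : ℝ} (hs : 0 < s) (ht : 0 < t) :
    s * t * p.coverProfile k (s / (s * t)) =
      s * p.activeProb / 2 * (2 * t * (1 - (1 - -p.γ * t ^ (-p.α))⁻¹ ^ k)) := by
  have h1 : s / (s * t) = t⁻¹ := by field_simp
  rw [h1, coverProfile, max_eq_left (inv_nonneg.2 ht.le), Real.inv_rpow ht.le,
    ← Real.rpow_neg ht.le, sub_eq_add_neg 1 (-p.γ * _), neg_mul, neg_neg]
  ring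

lemma isProfile_coverProfile (k : ℕ) : IsProfile (p.coverProfile k) := by
  have hγ := p.γ_pos
  have hL := p.activeProb_pos
  have hL1 := p.activeProb_lt_one
  have hα : 0 ≤ p.α := by linarith [p.two_lt_α]
  have hpow : ∀ x : ℝ, 0 ≤ max x 0 ^ p.α := fun x => Real.rpow_nonneg (le_max_right _ _) _
  have hbase : ∀ x : ℝ, 0 < 1 + p.γ * max x 0 ^ p.α := fun x => by
    have := hpow x
    positivity
  have hcont : Continuous (p.coverProfile k) := by
    unfold coverProfile
    refine continuous_const.mul (continuous_const.sub (Continuous.pow (Continuous.inv₀ ?_ ?_) k))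
    · exact continuous_const.add (continuous_const.mul
        ((continuous_id.max continuous_const).rpow_const fun _ => Or.inr hα))
    · exact fun x => (hbase x).ne'
  have hmono : Monotone (p.coverProfile k) := fun x y hxy => by
    have h1 : max x 0 ^ p.α ≤ max y 0 ^ p.α :=
      Real.rpow_le_rpow (le_max_right _ _) (max_le_max_right 0 hxy) hα
    have h2 : (1 + p.γ * max y 0 ^ p.α)⁻¹ ≤ (1 + p.γ * max x 0 ^ p.α)⁻¹ :=
      inv_anti₀ (hbase x) (by nlinarith)
    have h3 := pow_le_pow_left₀ (inv_nonneg.2 (hbase y).le) h2 k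
    exact mul_le_mul_of_nonneg_left (by linarith) hL.le
  have hzero : p.coverProfile k 0 = 0 := by
    simp [coverProfile, Real.zero_rpow (by linarith [p.two_lt_α] : p.α ≠ 0)]
  have hlt : ∀ x, p.coverProfile k x < 1 := fun x => by
    have := pow_pos (inv_pos.2 (hbase x)) k
    unfold coverProfile
    nlinarith
  refine ⟨hcont, hmono, hzero, hlt, fun s hs => ?_⟩
  rcases hs.eq_or_lt with rfl | hs
  · simp [hzero]
  -- Near the origin the integrand is bounded; beyond `s` it is a rescaling of the integrand
  -- of the hypergeometric function.
  rw [← Ioc_union_Ioi_eq_Ioi hs.le]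
  refine IntegrableOn.union ?_ ?_
  · refine Measure.integrableOn_of_bounded (M := s) (by simp)
      (Measurable.aestronglyMeasurable (by have := hcont.measurable; fun_prop))
      ((ae_restrict_iff' measurableSet_Ioc).2 (Eventually.of_forall fun r hr => ?_))
    have h0 : 0 ≤ p.coverProfile k (s / r) := hzero ▸ hmono (div_nonneg hs.le hr.1.le)
    rw [Real.norm_of_nonneg (mul_nonneg hr.1.le h0)]
    nlinarith [hlt (s / r), hr.1, hr.2]
  · have h1 := integrableOn_Ioi_comp_mul_left_iff (fun r => r * p.coverProfile k (s / r)) 1 hs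
    rw [mul_one] at h1
    have h2 : IntegrableOn (fun t => s * p.activeProb / 2 *
        (2 * t * (1 - (1 - -p.γ * t ^ (-p.α))⁻¹ ^ k))) (Ioi 1) :=
      (integrableOn_hypExcess p.two_lt_α (by linarith)).const_mul _
    exact h1.1 (h2.congr_fun (fun t (ht : 1 < t) =>
      (p.coverProfile_scaled k hs (one_pos.trans ht)).symm) measurableSet_Ioi)

lemma meanRemoved_coverProfile (k : ℕ) {r : ℝ} (hr : 0 < r) :
    meanRemoved (p.coverProfile k) r r = r ^ 2 / 2 * p.calF k := by
  have h1 := integral_comp_mul_left_Ioi (fun x => x * p.coverProfile k (r / x)) 1 hr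
  rw [mul_one] at h1
  have h2 : ∫ t in Ioi (1 : ℝ), r * t * p.coverProfile k (r / (r * t)) =
      r * p.activeProb / 2 * hypExcess p.α k (-p.γ) := by
    rw [hypExcess, ← integral_const_mul]
    exact setIntegral_congr_fun measurableSet_Ioi fun t (ht : 1 < t) =>
      p.coverProfile_scaled k hr (one_pos.trans ht)
  rw [h2, smul_eq_mul, eq_inv_mul_iff_mul_eq₀ hr.ne'] at h1
  rw [meanRemoved, ← h1, calF_eq]
  ring

lemma nearestDensity_coverProfile (k : ℕ) {r : ℝ} (hr : 0 < r) :
    nearestDensity (p.coverProfile k) p.lamBS r r =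
      (1 - p.coverProfile k 1) * (2 * Real.pi * p.lamBS *
        (Real.exp (-(Real.pi * p.lamBS * r ^ 2 * p.calF k)) * r)) := by
  rw [nearestDensity, p.meanRemoved_coverProfile k hr, div_self hr.ne',
    show 2 * Real.pi * p.lamBS * (r ^ 2 / 2 * p.calF k) =
      Real.pi * p.lamBS * r ^ 2 * p.calF k by ring]
  ring

/-! ### The serving station -/

lemma pathLoss_le_iff {r r' : ℝ} (hr : 0 ≤ r) (hr' : 0 ≤ r') :
    p.pathLoss r ≤ p.pathLoss r' ↔ r ≤ r' := by
  unfold pathLoss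
  rw [mul_le_mul_iff_right₀ p.K_pos, Real.rpow_le_rpow_iff hr hr' (by linarith [p.two_lt_α])]

lemma norm_serving_eq_iInf {x : ℕ → Plane} (hx : ∃ n, ∀ m, ‖x n‖ ≤ ‖x m‖) :
    ‖x (p.serving x)‖ = ⨅ n, ‖x n‖ := by
  have hne : {n : ℕ | ∀ m, p.pathLoss ‖x n‖ ≤ p.pathLoss ‖x m‖}.Nonempty := by
    obtain ⟨n, hn⟩ := hx
    exact ⟨n, fun m => (p.pathLoss_le_iff (norm_nonneg _) (norm_nonneg _)).2 (hn m)⟩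
  have hs := Nat.sInf_mem hne
  refine le_antisymm ((le_iInf_norm_iff x _).2 fun m => ?_) ((le_iInf_norm_iff x _).1 le_rfl _)
  exact (p.pathLoss_le_iff (norm_nonneg _) (norm_nonneg _)).1 (hs m)

lemma measurable_serving : Measurable p.serving := by
  set S : ℕ → Set (ℕ → Plane) := fun n => {x | ∀ m, p.pathLoss ‖x n‖ ≤ p.pathLoss ‖x m‖}
  have hS : ∀ n, MeasurableSet (S n) := fun n => by
    have hl : ∀ m, Measurable fun x : ℕ → Plane => p.pathLoss ‖x m‖ := fun m => by
      unfold pathLoss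
      fun_prop
    simp only [S, ofPred_forall]
    exact MeasurableSet.iInter fun m => measurableSet_le (hl n) (hl m)
  refine measurable_to_countable' fun n => ?_
  have : p.serving ⁻¹' {n} =
      (S n ∩ ⋂ m ∈ Finset.range n, (S m)ᶜ) ∪ ({x | n = 0} ∩ ⋂ m, (S m)ᶜ) := by
    ext x
    simp only [mem_preimage, mem_singleton_iff, mem_union, mem_inter_iff, mem_iInter,
      Finset.mem_range, mem_compl_iff, mem_ofPred_eq]
    have hmem : ∀ m, m ∈ {n : ℕ | ∀ m, p.pathLoss ‖x n‖ ≤ p.pathLoss ‖x m‖} ↔ x ∈ S m :=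
      fun m => Iff.rfl
    constructor
    · rintro rfl
      rcases eq_empty_or_nonempty {n : ℕ | ∀ m, p.pathLoss ‖x n‖ ≤ p.pathLoss ‖x m‖} with h | h
      · refine Or.inr ⟨by simp [serving, h], fun m hm => ?_⟩
        have := (hmem m).2 hm
        rw [h] at this
        exact this
      · exact Or.inl ⟨Nat.sInf_mem h, fun m hm hmS => Nat.notMem_of_lt_sInf hm hmS⟩
    · rintro (⟨h1, h2⟩ | ⟨rfl, h⟩)
      · refine le_antisymm (Nat.sInf_le h1) ?_
        by_contra hlt
        have hne : {n : ℕ | ∀ m, p.pathLoss ‖x n‖ ≤ p.pathLoss ‖x m‖}.Nonempty := ⟨n, h1⟩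
        exact h2 _ (not_le.1 hlt) (Nat.sInf_mem hne)
      · have : {n : ℕ | ∀ m, p.pathLoss ‖x n‖ ≤ p.pathLoss ‖x m‖} = ∅ :=
          eq_empty_of_forall_notMem fun m hm => h m hm
        simp [serving, this]
  rw [this]
  refine ((hS n).inter (MeasurableSet.biInter (Finset.countable_toSet _)
    fun m _ => (hS m).compl)).union ((MeasurableSet.const _).inter
      (MeasurableSet.iInter fun m => (hS m).compl))

lemma measurable_apply_serving : Measurable fun x : ℕ → Plane => x (p.serving x) := by
  have : Measurable fun q : ℕ × (ℕ → Plane) => q.2 q.1 :=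
    measurable_from_prod_countable_right fun n => measurable_pi_apply n
  exact this.comp (p.measurable_serving.prodMk measurable_id)

lemma measurable_strictG (c : Criterion) : Measurable (p.strictG c) := by
  cases c with
  | sir => exact measurable_const
  | sinr =>
    unfold strictG
    fun_prop
  | sirAsnr =>
    exact Measurable.ite (measurableSet_lt measurable_id measurable_const) measurable_const
      measurable_const

lemma measurable_coverProb (c : Criterion) :
    Measurable fun q : (ℕ → Plane) × (ℕ → Bool) => p.coverProb c q.1 q.2 := by
  have hs := p.measurable_serving
  have hx := p.measurable_apply_serving
  have hG := p.measurable_strictG c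
  have hw : ∀ n, Measurable fun q : (ℕ → Plane) × (ℕ → Bool) =>
      p.interferenceWeight q.1 q.2 n := fun n => by
    unfold interferenceWeight
    refine Measurable.ite ?_ ?_ measurable_const
    · exact (measurableSet_eq_fun measurable_const (hs.comp measurable_fst)).compl.inter
        (measurableSet_eq_fun ((measurable_pi_apply n).comp measurable_snd) measurable_const)
    · have h1 := (hx.comp (measurable_fst (α := ℕ → Plane) (β := ℕ → Bool))).norm
      have h2 : Measurable fun q : (ℕ → Plane) × (ℕ → Bool) => ‖q.1 n‖ := by fun_prop
      exact ((h1.div h2).pow_const _).const_mul _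
  unfold coverProb
  refine Measurable.mul ?_ ?_
  · exact (hG.comp ((hx.comp measurable_fst).norm)).ennreal_ofReal
  · exact measurable_expNeg.comp (Measurable.tsum fun n =>
      ((hw n).const_add 1).log.ennreal_ofReal)

lemma strictG_mem_Icc (c : Criterion) {r : ℝ} (hr : 0 ≤ r) : p.strictG c r ∈ Icc (0 : ℝ) 1 := by
  cases c with
  | sir => simp [strictG]
  | sinr =>
    refine ⟨(Real.exp_pos _).le, Real.exp_le_one_iff.2 (neg_nonpos.2 ?_)⟩
    have := p.γ_pos
    have := p.W_pos
    have := p.K_pos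
    have := p.P_pos
    positivity
  | sirAsnr =>
    simp only [strictG]
    split_ifs <;> simp

lemma coverProb_le_one (c : Criterion) (x : ℕ → Plane) (a : ℕ → Bool) : p.coverProb c x a ≤ 1 :=
  mul_le_one' (ENNReal.ofReal_le_one.2 (p.strictG_mem_Icc c (norm_nonneg _)).2) (expNeg_le_one _)

lemma strictG_ae_eq_calG (c : Criterion) : p.strictG c =ᵐ[volume] p.calG c := by
  filter_upwards [Measure.ae_ne volume ((p.P / (p.K * p.W * p.θ)) ^ (1 / p.α))] with r hr
  cases c with
  | sir => rfl
  | sinr => rfl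
  | sirAsnr => simp only [strictG, calG, lt_iff_le_and_ne, hr, ne_eq, not_false_eq_true, and_true]

/-! ### Averaging over the network -/

variable {Ω : Type*} [MeasurableSpace Ω] {μ : Measure Ω} {A : ℕ → Ω → Bool}

/-- Averaging over the activity of one station replaces `(1 + y) ^ (-k)` by
`1 - L + L (1 + y) ^ (-k)`. -/
lemma lintegral_activity [IsProbabilityMeasure μ] {B : Ω → Bool} (hB : Measurable B)
    (hp : μ {ω | B ω = true} = ENNReal.ofReal p.activeProb) (k : ℕ) {y : ℝ} (hy : 0 ≤ y) :
    ∫⁻ ω, expNeg (k * ENNReal.ofReal (Real.log (1 + if B ω = true then y else 0))) ∂μ =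
      ENNReal.ofReal (1 - p.activeProb * (1 - (1 + y)⁻¹ ^ k)) := by
  have hL := p.activeProb_pos
  have hL1 := p.activeProb_lt_one
  have hfalse : μ.map B {false} = ENNReal.ofReal (1 - p.activeProb) := by
    rw [Measure.map_apply hB (measurableSet_singleton _), ENNReal.ofReal_sub _ hL.le,
      ENNReal.ofReal_one, ← hp, ← measure_univ (μ := μ)]
    change _ = μ univ - μ (B ⁻¹' {true})
    rw [← measure_compl (hB (measurableSet_singleton true)) (measure_ne_top _ _)]
    congr 1
    ext ω
    simp
  have htrue : μ.map B {true} = ENNReal.ofReal p.activeProb := by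
    rw [Measure.map_apply hB (measurableSet_singleton _), ← hp]
    rfl
  have h1y : 0 < (1 + y)⁻¹ := by positivity
  rw [← lintegral_map (f := fun b : Bool => expNeg (k * ENNReal.ofReal (Real.log (1 +
    if b = true then y else 0)))) .of_discrete hB, lintegral_fintype]
  simp only [Fintype.sum_bool, htrue, hfalse, if_true, Bool.false_eq_true, if_false, add_zero,
    Real.log_one, ENNReal.ofReal_zero, mul_zero, expNeg_zero, one_mul]
  rw [expNeg_nat_mul, expNeg_ofReal (Real.log_nonneg (by linarith)), Real.exp_neg,
    Real.exp_log (by linarith), ← ENNReal.ofReal_pow h1y.le, ← ENNReal.ofReal_mul (by positivity),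
    ← ENNReal.ofReal_add (by positivity) (by linarith)]
  congr 1
  ring

/-- The `k`-th moment of the coverage probability, averaged over the activity of the stations. The
factor on the left is the one that the serving station would contribute as an interferer. -/
lemma lintegral_coverProb_pow_active [IsProbabilityMeasure μ] (c : Criterion) (k : ℕ)
    {x : ℕ → Plane} (hx : ∀ n, x n ≠ 0) (hmin : ∃ n, ∀ m, ‖x n‖ ≤ ‖x m‖)
    (hA : ∀ n, Measurable (A n))
    (hp : ∀ n, μ {ω | A n ω = true} = ENNReal.ofReal p.activeProb) (hi : iIndepFun A μ) :
    ENNReal.ofReal (1 - p.coverProfile k 1) * ∫⁻ ω, p.coverProb c x (fun n => A n ω) ^ k ∂μ =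
      expNeg (∑' n, attenuation (p.coverProfile k) (⨅ n, ‖x n‖) ‖x n‖) *
        ENNReal.ofReal (p.strictG c (⨅ n, ‖x n‖) ^ k) := by
  have hγ := p.γ_pos
  have hw := p.isProfile_coverProfile k
  set s := p.serving x
  set w := p.coverProfile k
  have hR : ‖x s‖ = ⨅ n, ‖x n‖ := p.norm_serving_eq_iInf hmin
  rw [← hR]
  set r0 := ‖x s‖
  have hr0 : 0 < r0 := norm_pos_iff.2 (hx s)
  have hG := p.strictG_mem_Icc c hr0.le
  set z : ℕ → ℝ≥0∞ := fun n => if n = s then 0 else attenuation w r0 ‖x n‖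
  have hZ : ∫⁻ ω, expNeg (∑' n, k * ENNReal.ofReal (Real.log (1 +
      p.interferenceWeight x (fun n => A n ω) n))) ∂μ = expNeg (∑' n, z n) := by
    refine lintegral_expNeg_tsum (Z := fun n ω => k * ENNReal.ofReal (Real.log (1 +
      p.interferenceWeight x (fun n => A n ω) n))) (fun n => ?_) ?_ (fun n => ?_)
    · exact (show Measurable fun b : Bool => (k : ℝ≥0∞) * ENNReal.ofReal (Real.log (1 +
        if n ≠ s ∧ b = true then p.γ * (r0 / ‖x n‖) ^ p.α else 0)) from .of_discrete).comp (hA n)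
    · exact hi.comp (fun n b => (k : ℝ≥0∞) * ENNReal.ofReal (Real.log (1 +
        if n ≠ s ∧ b = true then p.γ * (r0 / ‖x n‖) ^ p.α else 0))) fun n => .of_discrete
    · by_cases hn : n = s
      · simp [z, interferenceWeight, hn, s]
      · have h1 : ∀ ω, p.interferenceWeight x (fun n => A n ω) n =
            if A n ω = true then p.γ * (r0 / ‖x n‖) ^ p.α else 0 := fun ω => by
          have hn' : n ≠ p.serving x := hn
          simp only [interferenceWeight, ne_eq, hn', not_false_eq_true, true_and]
          rfl
        simp only [h1]
        rw [p.lintegral_activity (hA n) (hp n) k (by positivity)]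
        simp only [z, if_neg hn]
        rw [hw.expNeg_attenuation hr0.le (norm_nonneg _)]
        simp only [w, coverProfile]
        rw [max_eq_left (div_nonneg hr0.le (norm_nonneg _))]
  have hcp : ∀ ω, p.coverProb c x (fun n => A n ω) ^ k = ENNReal.ofReal (p.strictG c r0 ^ k) *
      expNeg (∑' n, k * ENNReal.ofReal (Real.log (1 +
        p.interferenceWeight x (fun n => A n ω) n))) := fun ω => by
    rw [coverProb, mul_pow, ← expNeg_nat_mul, ENNReal.tsum_mul_left, ENNReal.ofReal_pow hG.1]
  simp_rw [hcp]
  have hsum : ∑' n, attenuation w r0 ‖x n‖ = attenuation w r0 r0 + ∑' n, z n := by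
    rw [ENNReal.tsum_eq_add_tsum_ite (f := fun n => attenuation w r0 ‖x n‖) s]
    congr! 3 with n
    by_cases h : n = s <;> simp [z, h]
  rw [lintegral_const_mul' _ _ ENNReal.ofReal_ne_top, hZ, hsum, expNeg_add,
    hw.expNeg_attenuation hr0.le hr0.le, div_self hr0.ne']
  ring

end Params

section Network

variable {Ω : Type*} [MeasurableSpace Ω] {μ : Measure Ω} {X : ℕ → Ω → Plane} {lam : ℝ}

lemma IsHomogeneousPPP.ae_ne_zero (hX : IsHomogeneousPPP μ X lam) :
    ∀ᵐ ω ∂μ, ∀ n, X n ω ≠ 0 := by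
  have h := (hX.count_law {0} (measurableSet_singleton 0) (by simp)).measure_eq
    (p := fun k => k ≠ 0) .of_discrete
  rw [Measure.map_apply .of_discrete .of_discrete] at h
  have h0 : poissonMeasure (ENNReal.ofReal lam * volume ({0} : Set Plane)).toNNReal
      ((Nat.cast : ℕ → ℕ∞) ⁻¹' {k | k ≠ 0}) = 0 := by
    have : (Nat.cast : ℕ → ℕ∞) ⁻¹' {k | k ≠ 0} = {0}ᶜ := by ext; simp
    rw [this, prob_compl_eq_zero_iff (measurableSet_singleton 0), poissonMeasure_singleton]
    simp
  rw [h0] at h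
  have h1 : ∀ᵐ ω ∂μ, pointCount (fun n => X n ω) {0} = 0 := by
    rw [ae_iff]
    exact h
  filter_upwards [h1] with ω hω n hn
  rw [pointCount, encard_eq_zero] at hω
  exact (hω.subset (show n ∈ {n : ℕ | X n ω ∈ ({0} : Set Plane)} from hn)).elim

lemma IsHomogeneousPPP.ae_exists_nearest (hX : IsHomogeneousPPP μ X lam) :
    ∀ᵐ ω ∂μ, ∃ n, ∀ m, ‖X n ω‖ ≤ ‖X m ω‖ := by
  have hfin : ∀ N : ℕ, ∀ᵐ ω ∂μ, pointCount (fun n => X n ω) (Metric.ball 0 N) ≠ ⊤ := fun N => by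
    have h := (hX.count_law (Metric.ball 0 N) measurableSet_ball measure_ball_lt_top.ne).measure_eq
      (p := fun k => k = ⊤) .of_discrete
    rw [Measure.map_apply .of_discrete .of_discrete] at h
    have h0 : (Nat.cast : ℕ → ℕ∞) ⁻¹' {k | k = ⊤} = ∅ := by ext; simp
    rw [h0, measure_empty] at h
    rw [ae_iff]
    simpa using h
  filter_upwards [ae_all_iff.2 hfin] with ω hω
  obtain ⟨N, hN⟩ := exists_nat_gt ‖X 0 ω‖
  have hf : {n : ℕ | X n ω ∈ Metric.ball (0 : Plane) N}.Finite := by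
    simpa [pointCount, encard_ne_top_iff] using hω N
  have h0 : 0 ∈ {n : ℕ | X n ω ∈ Metric.ball (0 : Plane) N} := by simpa using hN
  obtain ⟨n, -, hmin⟩ := exists_min_image _ (fun n => ‖X n ω‖) hf ⟨0, h0⟩
  refine ⟨n, fun m => ?_⟩
  by_cases hm : m ∈ {n : ℕ | X n ω ∈ Metric.ball (0 : Plane) N}
  · exact hmin m hm
  · have : (N : ℝ) ≤ ‖X m ω‖ := by simpa using hm
    exact (hmin 0 h0).trans (hN.le.trans this)

variable {p : Params} {A : ℕ → Ω → Bool}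

lemma Params.integrableOn_moment (p : Params) (k : ℕ) {G : ℝ → ℝ} (hG : AEStronglyMeasurable G)
    (hG1 : ∀ᵐ r, 0 ≤ r → ‖G r‖ ≤ 1) :
    IntegrableOn (fun r => G r * Real.exp (-(Real.pi * p.lamBS * r ^ 2 * p.calF k)) * r)
      (Ioi 0) := by
  have hb : 0 < Real.pi * p.lamBS * p.calF k :=
    mul_pos (mul_pos Real.pi_pos p.lamBS_pos) (by linarith [p.one_le_calF k])
  have h := (integrable_mul_exp_neg_mul_sq hb).integrableOn (s := Ioi (0 : ℝ))
  refine Integrable.mono h ((hG.restrict.mul (Continuous.aestronglyMeasurable (by fun_prop))).mul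
    (Continuous.aestronglyMeasurable (by fun_prop))) ?_
  filter_upwards [ae_restrict_mem measurableSet_Ioi, ae_restrict_of_ae hG1] with r hr h1
  rw [norm_mul, norm_mul, norm_mul, mul_comm ‖r‖,
    show -(Real.pi * p.lamBS * p.calF k) * r ^ 2 =
      -(Real.pi * p.lamBS * r ^ 2 * p.calF k) by ring]
  exact mul_le_mul_of_nonneg_right
    (mul_le_of_le_one_left (norm_nonneg _) (h1 (le_of_lt hr))) (norm_nonneg _)

lemma lintegral_comp_prodMk_of_indepFun [IsProbabilityMeasure μ] {β γ : Type*} [MeasurableSpace β]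
    [MeasurableSpace γ] {Y : Ω → β} {Z : Ω → γ} (hY : Measurable Y) (hZ : Measurable Z)
    (hind : IndepFun Y Z μ) {F : β × γ → ℝ≥0∞} (hF : Measurable F) :
    ∫⁻ ω, F (Y ω, Z ω) ∂μ = ∫⁻ ω, ∫⁻ ω', F (Y ω, Z ω') ∂μ ∂μ := by
  have : IsProbabilityMeasure (μ.map Z) := Measure.isProbabilityMeasure_map hZ.aemeasurable
  rw [← lintegral_map hF (hY.prodMk hZ),
    (indepFun_iff_map_prod_eq_prod_map_map hY.aemeasurable hZ.aemeasurable).1 hind,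
    lintegral_prod _ hF.aemeasurable, lintegral_map hF.lintegral_prod_right' hY]
  exact lintegral_congr fun ω => lintegral_map (hF.comp measurable_prodMk_left) hZ

/-- The moments of the coverage probability. -/
lemma IsNetwork.lintegral_coverProb_pow [IsProbabilityMeasure μ] (hnet : IsNetwork μ p X A)
    (c : Criterion) (k : ℕ) :
    ∫⁻ ω, p.coverProb c (fun n => X n ω) (fun n => A n ω) ^ k ∂μ =
      ENNReal.ofReal (2 * Real.pi * p.lamBS * ∫ r in Ioi (0 : ℝ),
        p.strictG c r ^ k * Real.exp (-(Real.pi * p.lamBS * r ^ 2 * p.calF k)) * r) := by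
  have hpi := Real.pi_pos
  have hlam := p.lamBS_pos
  have hw := p.isProfile_coverProfile k
  have hXm : Measurable fun ω n => X n ω := measurable_pi_lambda _ hnet.ppp.measurable
  have hAm : Measurable fun ω n => A n ω := measurable_pi_lambda _ hnet.measurable_active
  have hF := (p.measurable_coverProb c).pow_const k
  have hfub : ∫⁻ ω, p.coverProb c (fun n => X n ω) (fun n => A n ω) ^ k ∂μ =
      ∫⁻ ω, ∫⁻ ω', p.coverProb c (fun n => X n ω) (fun n => A n ω') ^ k ∂μ ∂μ :=
    lintegral_comp_prodMk_of_indepFun hXm hAm hnet.indep hF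
  set κ := 1 - p.coverProfile k 1
  have hκ : 0 < κ := by
    have := hw.lt_one 1
    simp only [κ]
    linarith
  have hκ0 : ENNReal.ofReal κ ≠ 0 := by simpa using hκ
  -- The restriction to nonnegative distances makes the test function bounded by one.
  set f : ℝ → ℝ≥0∞ := fun r => ENNReal.ofReal (p.strictG c (max r 0) ^ k)
  have hf : Measurable f :=
    (((p.measurable_strictG c).comp
      (measurable_id.max measurable_const)).pow_const k).ennreal_ofReal
  have hf1 : ∀ r, f r ≤ 1 := fun r => by
    have := p.strictG_mem_Icc c (le_max_right r 0)
    exact ENNReal.ofReal_le_one.2 (pow_le_one₀ this.1 this.2)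
  have hmom : IntegrableOn (fun r => p.strictG c r ^ k *
      Real.exp (-(Real.pi * p.lamBS * r ^ 2 * p.calF k)) * r) (Ioi 0) := by
    refine p.integrableOn_moment k ((p.measurable_strictG c).pow_const k).aestronglyMeasurable
      (Eventually.of_forall fun r hr => ?_)
    have := p.strictG_mem_Icc c hr
    rw [norm_pow, Real.norm_of_nonneg this.1]
    exact pow_le_one₀ this.1 this.2
  have hnn : ∀ r, 0 < r → 0 ≤ p.strictG c r ^ k *
      Real.exp (-(Real.pi * p.lamBS * r ^ 2 * p.calF k)) * r := fun r hr => by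
    have := (p.strictG_mem_Icc c hr.le).1
    positivity
  have key : ENNReal.ofReal κ *
      ∫⁻ ω, p.coverProb c (fun n => X n ω) (fun n => A n ω) ^ k ∂μ =
      ENNReal.ofReal κ * ENNReal.ofReal (2 * Real.pi * p.lamBS * ∫ r in Ioi (0 : ℝ),
        p.strictG c r ^ k * Real.exp (-(Real.pi * p.lamBS * r ^ 2 * p.calF k)) * r) := by
    rw [hfub, ← lintegral_const_mul' _ _ ENNReal.ofReal_ne_top]
    have h1 : ∀ᵐ ω ∂μ, ENNReal.ofReal κ *
        ∫⁻ ω', p.coverProb c (fun n => X n ω) (fun n => A n ω') ^ k ∂μ =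
        expNeg (∑' n, attenuation (p.coverProfile k) (⨅ n, ‖X n ω‖) ‖X n ω‖) *
          f (⨅ n, ‖X n ω‖) := by
      filter_upwards [hnet.ppp.ae_ne_zero, hnet.ppp.ae_exists_nearest] with ω h0 hmin
      rw [p.lintegral_coverProb_pow_active c k h0 hmin hnet.measurable_active hnet.active_prob
        hnet.active_indep]
      simp only [f]
      rw [max_eq_left (iInf_norm_nonneg _)]
    rw [lintegral_congr_ae h1, hnet.ppp.lintegral_nearest hlam hw hf hf1,
      ← ENNReal.ofReal_mul hκ.le, ← integral_const_mul, ← integral_const_mul,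
      ofReal_integral_eq_lintegral_ofReal ((hmom.const_mul _).const_mul _)
        ((ae_restrict_iff' measurableSet_Ioi).2 (Eventually.of_forall fun r hr => by
          have := hnn r hr
          positivity))]
    refine setLIntegral_congr_fun measurableSet_Ioi fun r (hr : 0 < r) => ?_
    have hd := p.nearestDensity_coverProfile k hr
    simp only [f, max_eq_left hr.le]
    rw [← ENNReal.ofReal_mul (hw.nearestDensity_nonneg hlam hr.le), hd]
    congr 1
    ring
  exact (ENNReal.mul_right_inj hκ0 ENNReal.ofReal_ne_top).1 key

end Network

end CellularDelay

theorem mainTheorem1 {Ω Ω' : Type*} [MeasurableSpace Ω] [MeasurableSpace Ω']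
    (μ : Measure Ω) [IsProbabilityMeasure μ] (ν : Measure Ω') [IsProbabilityMeasure ν]
    (p : CellularDelay.Params)
    (X : ℕ → Ω → CellularDelay.Plane) (A : ℕ → Ω → Bool)
    (hnet : CellularDelay.IsNetwork μ p X A)
    (h : ℕ → ℕ → Ω' → ℝ) (hfad : CellularDelay.IsRayleighFading ν h)
    (c : CellularDelay.Criterion) (τ : ℕ) :
    Integrable
      (fun ω => p.condDelayCCDF ν h c (fun n => X n ω) (fun n => A n ω) τ) μ ∧
    (∀ k ∈ Finset.range (τ + 1),
      IntegrableOn (fun r : ℝ =>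
        (p.calG c r) ^ k * Real.exp (-(Real.pi * p.lamBS * r ^ 2 * p.calF k)) * r) (Ioi 0)) ∧
    p.F₁ μ ν X A h c τ =
      2 * Real.pi * p.lamBS * ∑ k ∈ Finset.range (τ + 1), (τ.choose k : ℝ) * (-1) ^ k *
        ∫ r in Ioi (0 : ℝ),
          (p.calG c r) ^ k * Real.exp (-(Real.pi * p.lamBS * r ^ 2 * p.calF k)) * r := by
  set q : Ω → ℝ := fun ω => (p.coverProb c (fun n => X n ω) (fun n => A n ω)).toReal
  have hqm : Measurable q := ((p.measurable_coverProb c).comp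
    ((measurable_pi_lambda _ hnet.ppp.measurable).prodMk
      (measurable_pi_lambda _ hnet.measurable_active))).ennreal_toReal
  have hq0 : ∀ ω, 0 ≤ q ω := fun ω => ENNReal.toReal_nonneg
  have hq1 : ∀ ω, q ω ≤ 1 := fun ω => by
    have := ENNReal.toReal_mono ENNReal.one_ne_top
      (p.coverProb_le_one c (fun n => X n ω) (fun n => A n ω))
    simpa using this
  have hint : ∀ g : Ω → ℝ, Measurable g → (∀ ω, 0 ≤ g ω) → (∀ ω, g ω ≤ 1) → Integrable g μ :=
    fun g hg h0 h1 => Integrable.of_bound hg.aestronglyMeasurable 1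
      (Eventually.of_forall fun ω => by rw [Real.norm_of_nonneg (h0 ω)]; exact h1 ω)
  have hpow : ∀ k, Integrable (fun ω => q ω ^ k) μ := fun k =>
    hint _ (hqm.pow_const k) (fun ω => pow_nonneg (hq0 ω) k) fun ω => pow_le_one₀ (hq0 ω) (hq1 ω)
  have hccdf : (fun ω => p.condDelayCCDF ν h c (fun n => X n ω) (fun n => A n ω) τ) =ᵐ[μ]
      fun ω => (1 - q ω) ^ τ := by
    filter_upwards [hnet.ppp.ae_ne_zero] with ω hω
    exact p.condDelayCCDF_eq hfad c hω _ τ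
  have hGae := p.strictG_ae_eq_calG c
  have hmoment : ∀ k, ∫ ω, q ω ^ k ∂μ = 2 * Real.pi * p.lamBS * ∫ r in Ioi (0 : ℝ),
      (p.calG c r) ^ k * Real.exp (-(Real.pi * p.lamBS * r ^ 2 * p.calF k)) * r := fun k => by
    have h1 : ∫ r in Ioi (0 : ℝ),
        (p.calG c r) ^ k * Real.exp (-(Real.pi * p.lamBS * r ^ 2 * p.calF k)) * r =
        ∫ r in Ioi (0 : ℝ),
          (p.strictG c r) ^ k * Real.exp (-(Real.pi * p.lamBS * r ^ 2 * p.calF k)) * r := by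
      refine integral_congr_ae (ae_restrict_of_ae (hGae.mono fun r hr => ?_))
      simp only [hr]
    have h2 : 0 ≤ ∫ r in Ioi (0 : ℝ),
        (p.strictG c r) ^ k * Real.exp (-(Real.pi * p.lamBS * r ^ 2 * p.calF k)) * r :=
      setIntegral_nonneg measurableSet_Ioi fun r (hr : 0 < r) => by
        have := (p.strictG_mem_Icc c hr.le).1
        positivity
    rw [integral_eq_lintegral_of_nonneg_ae (Eventually.of_forall fun ω => pow_nonneg (hq0 ω) k)
      (hqm.pow_const k).aestronglyMeasurable, h1]
    have h3 : ∀ ω, ENNReal.ofReal (q ω ^ k) =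
        p.coverProb c (fun n => X n ω) (fun n => A n ω) ^ k := fun ω => by
      rw [ENNReal.ofReal_pow (hq0 ω), ENNReal.ofReal_toReal
        (ne_top_of_le_ne_top ENNReal.one_ne_top (p.coverProb_le_one c _ _))]
    simp_rw [h3]
    rw [hnet.lintegral_coverProb_pow, ENNReal.toReal_ofReal]
    have := Real.pi_pos
    have := p.lamBS_pos
    positivity
  refine ⟨?_, fun k _ => ?_, ?_⟩
  · refine (hint _ ((hqm.const_sub 1).pow_const τ) (fun ω => ?_) fun ω => ?_).congr hccdf.symm
    · exact pow_nonneg (by linarith [hq1 ω]) τ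
    · exact pow_le_one₀ (by linarith [hq1 ω]) (by linarith [hq0 ω])
  · refine p.integrableOn_moment k ?_ ?_
    · exact (((p.measurable_strictG c).pow_const k).aestronglyMeasurable).congr
        (hGae.mono fun r hr => by simp only [hr])
    · filter_upwards [hGae] with r hr hr0
      have := p.strictG_mem_Icc c hr0
      rw [← hr, norm_pow, Real.norm_of_nonneg this.1]
      exact pow_le_one₀ this.1 this.2
  · have hbin : ∀ ω, (1 - q ω) ^ τ =
        ∑ k ∈ Finset.range (τ + 1), (τ.choose k : ℝ) * (-1) ^ k * q ω ^ k := fun ω => by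
      rw [sub_eq_neg_add, add_pow]
      refine Finset.sum_congr rfl fun k _ => ?_
      rw [neg_pow]
      ring
    rw [CellularDelay.Params.F₁, integral_congr_ae hccdf]
    simp_rw [hbin]
    rw [integral_finsetSum _ fun k _ => (hpow k).const_mul _, Finset.mul_sum]
    refine Finset.sum_congr rfl fun k _ => ?_
    rw [integral_const_mul, hmoment]
    ring
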